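/- A \emph{real C*-algebra} is a (not necessarily unital) real Banach *-algebra $A$ with $\|a^*a\| = \|a\|^2$ for all $a \in A$ and with $1 + a^*a$ invertible in the unitization $A^+ = \mathbb{R} \oplus A$ for all $a \in A$. It is \emph{simple} if $A \neq 0$ and its only closed two-sided ideals are $0$ and $A$. A projection is an element $p = p^* = p^2$; projections $p, q$ are Murray–von Neumann equivalent, $p \sim q$, if $p = v^*v$ and $q = vv^*$ for some $v \in A$; $p$ is \emph{infinite} if it is equivalent to a proper subprojection of itself. $A$ is \emph{purely infinite} if for every nonzero positive $x \in A$ the hereditary subalgebra $\overline{xAx}$ contains an infinite projection. For a unital real C*-algebra $B$, $K_0(B)$ is the Grothendieck group of the monoid (under block sum) of Murray–von Neumann classes of projections in the matrix algebras $M_n(B)$, $n \geq 0$; and $KO_0(A)$ denotes the kernel of $K_0(A^+) \to K_0(\mathbb{R})$, induced by the projection $A^+ \to \mathbb{R}$ with kernel $A$. \textbf{Proposition.} Let $A$ be a real simple purely infinite C*-algebra and let $V = \{[p] \mid p \text{ a nonzero projection in } A\}$ be the set of Murray–von Neumann classes of its nonzero projections. Then for any nonzero projections $p, q$ in $A$ there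 are projections $p' \sim p$ and $q' \sim q$ in $A$ with $p'q' = 0$; there is an abelian group structure on $V$ with $[p] + [q] = [p + q]$ whenever $p, q$ are nonzero projections with $pq = 0$; and the map sending $[p] \in V$ to the class of $p$ in $KO_0(A)$ is a well-defined isomorphism of groups $$V \;\cong\; KO_0(A).$$ -/

import Mathlib

/-- A real C⋆-algebra (not necessarily unital): a real Banach ⋆-algebra satisfying the C⋆-identity
and such that `1 + a⋆a` is invertible in the unitization for every `a`. -/
class RealCStarAlgebra (A : Type*) extends NonUnitalNormedRing A, StarRing A, CompleteSpace A,
    CStarRing A, NormedSpace ℝ A, IsScalarTower ℝ A A, SMulCommClass ℝ A A, StarModule ℝ A where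
  isUnit_one_add_star_mul_self :
    ∀ a : A, IsUnit (1 + ((star a * a : A) : Unitization ℝ A))

namespace RealCStar

section Algebra

/-- A simple real C⋆-algebra: nonzero, with no closed two-sided ideals other than `0` and `A`. -/
def IsSimple (A : Type*) [RealCStarAlgebra A] : Prop :=
  Nontrivial A ∧ ∀ I : Submodule ℝ A, IsClosed (I : Set A) →
    (∀ a : A, ∀ x ∈ I, a * x ∈ I ∧ x * a ∈ I) → I = ⊥ ∨ I = ⊤

/-- Murray–von Neumann equivalence of elements (used for projections). -/
def MvN {A : Type*} [Mul A] [Star A] (p q : A) : Prop :=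
  ∃ v : A, star v * v = p ∧ v * star v = q

/-- A projection is infinite if it is equivalent to a proper subprojection of itself. -/
def IsInfiniteProjection {A : Type*} [Mul A] [Star A] (p : A) : Prop :=
  IsStarProjection p ∧ ∃ q : A, IsStarProjection q ∧ p * q = q ∧ q ≠ p ∧ MvN p q

/-- A real C⋆-algebra is purely infinite if for every nonzero positive element `x = y⋆y` the
hereditary subalgebra `closure (xAx)` contains an infinite projection. -/
def IsPurelyInfinite (A : Type*) [RealCStarAlgebra A] : Prop :=
  ∀ x : A, x ≠ 0 → (∃ y : A, x = star y * y) →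
    ∃ p ∈ closure (Set.range fun a : A => x * a * x), IsInfiniteProjection p

end Algebra

section NonzeroProjections

variable {A : Type*} [NonUnitalRing A] [StarRing A]

theorem MvN.trans {p q r : A} (hp : IsStarProjection p) (hr : IsStarProjection r)
    (h₁ : MvN p q) (h₂ : MvN q r) : MvN p r := by
  obtain ⟨v, hv, hv'⟩ := h₁
  obtain ⟨w, hw, hw'⟩ := h₂
  refine ⟨w * v, ?_, ?_⟩
  · calc star (w * v) * (w * v) = star v * (star w * w) * v := by simp [mul_assoc]
      _ = (star v * v) * (star v * v) := by rw [hw, ← hv']; simp [mul_assoc]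
      _ = p := by rw [hv, hp.isIdempotentElem.eq]
  · calc (w * v) * star (w * v) = w * (v * star v) * star w := by simp [mul_assoc]
      _ = (w * star w) * (w * star w) := by rw [hv', ← hw]; simp [mul_assoc]
      _ = r := by rw [hw', hr.isIdempotentElem.eq]

variable (A) in
/-- The nonzero projections of `A`. -/
abbrev NonzeroProjection : Type _ := {p : A // IsStarProjection p ∧ p ≠ 0}

variable (A) in
/-- Murray–von Neumann equivalence on the nonzero projections of `A`. -/
instance nonzeroProjectionSetoid : Setoid (NonzeroProjection A) where
  r p q := MvN p.1 q.1
  iseqv :=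
    { refl := fun p => ⟨p.1, by
        rw [p.2.1.isSelfAdjoint.star_eq, p.2.1.isIdempotentElem.eq]; exact ⟨rfl, rfl⟩⟩
      symm := fun ⟨v, h, h'⟩ => ⟨star v, by simpa using h', by simpa using h⟩
      trans := fun {p _ r} h₁ h₂ => h₁.trans p.2.1 r.2.1 h₂ }

variable (A) in
/-- The set of Murray–von Neumann classes of nonzero projections of `A`. -/
def NonzeroProjectionClass : Type _ := Quotient (nonzeroProjectionSetoid A)

/-- The Murray–von Neumann class `[p]` of a nonzero projection `p`. -/
def NonzeroProjection.toClass (p : NonzeroProjection A) : NonzeroProjectionClass A :=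
  Quotient.mk (nonzeroProjectionSetoid A) p

end NonzeroProjections

section KTheory

open Matrix

/-- Projections in the matrix algebras `Mₙ(R)`, `n ≥ 0`. -/
abbrev MatrixProjection (R : Type*) [Ring R] [StarRing R] : Type _ :=
  Σ n : ℕ, {p : Matrix (Fin n) (Fin n) R // IsStarProjection p}

/-- Murray–von Neumann equivalence of square matrices of possibly different sizes, through
rectangular matrices. -/
def MatrixMvN {R : Type*} [Ring R] [StarRing R] {ι κ : Type*} [Fintype ι] [Fintype κ]
    (p : Matrix ι ι R) (q : Matrix κ κ R) : Prop :=
  ∃ v : Matrix κ ι R, vᴴ * v = p ∧ v * vᴴ = q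

variable {R S : Type*} [Ring R] [StarRing R] [Ring S] [StarRing S]
  {ι κ μ ν : Type*} [Fintype ι] [Fintype κ] [Fintype μ] [Fintype ν]

theorem mul_self_of_isStarProjection {p : Matrix ι ι R} (hp : IsStarProjection p) : p * p = p :=
  hp.isIdempotentElem.eq

theorem conjTranspose_of_isStarProjection {p : Matrix ι ι R} (hp : IsStarProjection p) : pᴴ = p :=
  hp.isSelfAdjoint.star_eq

theorem isStarProjection_of {p : Matrix ι ι R} (h₁ : p * p = p) (h₂ : pᴴ = p) :
    IsStarProjection p := ⟨h₁, h₂⟩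

theorem MatrixMvN.refl {p : Matrix ι ι R} (hp : IsStarProjection p) : MatrixMvN p p :=
  ⟨p, by rw [conjTranspose_of_isStarProjection hp, mul_self_of_isStarProjection hp]
         exact ⟨rfl, rfl⟩⟩

theorem MatrixMvN.symm {p : Matrix ι ι R} {q : Matrix κ κ R} (h : MatrixMvN p q) :
    MatrixMvN q p := by
  obtain ⟨v, h₁, h₂⟩ := h
  exact ⟨vᴴ, by simpa using h₂, by simpa using h₁⟩

theorem MatrixMvN.trans {p : Matrix ι ι R} {q : Matrix κ κ R} {r : Matrix μ μ R}
    (hp : IsStarProjection p) (hr : IsStarProjection r)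
    (h₁ : MatrixMvN p q) (h₂ : MatrixMvN q r) : MatrixMvN p r := by
  obtain ⟨v, hv, hv'⟩ := h₁
  obtain ⟨w, hw, hw'⟩ := h₂
  refine ⟨w * v, ?_, ?_⟩
  · calc (w * v)ᴴ * (w * v) = vᴴ * (wᴴ * w) * v := by
          simp [Matrix.mul_assoc, conjTranspose_mul]
      _ = (vᴴ * v) * (vᴴ * v) := by rw [hw, ← hv']; simp [Matrix.mul_assoc]
      _ = p := by rw [hv, mul_self_of_isStarProjection hp]
  · calc (w * v) * (w * v)ᴴ = w * (v * vᴴ) * wᴴ := by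
          simp [Matrix.mul_assoc, conjTranspose_mul]
      _ = (w * wᴴ) * (w * wᴴ) := by rw [hv', ← hw]; simp [Matrix.mul_assoc]
      _ = r := by rw [hw', mul_self_of_isStarProjection hr]

theorem isStarProjection_submatrix {p : Matrix ι ι R} (hp : IsStarProjection p) (e : κ ≃ ι) :
    IsStarProjection (p.submatrix e e) :=
  isStarProjection_of
    (by rw [submatrix_mul_equiv, mul_self_of_isStarProjection hp])
    (by rw [conjTranspose_submatrix, conjTranspose_of_isStarProjection hp])

theorem MatrixMvN.submatrix {p : Matrix ι ι R} (hp : IsStarProjection p) (e : κ ≃ ι) :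
    MatrixMvN (p.submatrix e e) p := by
  refine ⟨p.submatrix id e, ?_, ?_⟩
  · rw [conjTranspose_submatrix, conjTranspose_of_isStarProjection hp,
      ← submatrix_mul _ _ _ _ _ Function.bijective_id, mul_self_of_isStarProjection hp]
  · rw [conjTranspose_submatrix, conjTranspose_of_isStarProjection hp, submatrix_mul_equiv,
      mul_self_of_isStarProjection hp, submatrix_id_id]

theorem isStarProjection_fromBlocks {p : Matrix ι ι R} {q : Matrix κ κ R}
    (hp : IsStarProjection p) (hq : IsStarProjection q) :
    IsStarProjection (fromBlocks p 0 0 q) :=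
  isStarProjection_of
    (by simp [fromBlocks_multiply, mul_self_of_isStarProjection hp,
      mul_self_of_isStarProjection hq])
    (by simp [fromBlocks_conjTranspose, conjTranspose_of_isStarProjection hp,
      conjTranspose_of_isStarProjection hq])

theorem MatrixMvN.fromBlocks {p : Matrix ι ι R} {q : Matrix κ κ R} {p' : Matrix μ μ R}
    {q' : Matrix ν ν R} (h₁ : MatrixMvN p p') (h₂ : MatrixMvN q q') :
    MatrixMvN (Matrix.fromBlocks p 0 0 q) (Matrix.fromBlocks p' 0 0 q') := by
  obtain ⟨v, hv, hv'⟩ := h₁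
  obtain ⟨w, hw, hw'⟩ := h₂
  exact ⟨Matrix.fromBlocks v 0 0 w, by
    simp [fromBlocks_conjTranspose, fromBlocks_multiply, hv, hv', hw, hw']⟩

variable (R) in
/-- Murray–von Neumann equivalence on the projections in matrix algebras over `R`. -/
instance matrixProjectionSetoid : Setoid (MatrixProjection R) where
  r p q := MatrixMvN p.2.1 q.2.1
  iseqv :=
    { refl := fun p => MatrixMvN.refl p.2.2
      symm := fun h => h.symm
      trans := fun {p _ r} h₁ h₂ => h₁.trans p.2.2 r.2.2 h₂ }

/-- The block sum `diag(p, q)`. -/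
def MatrixProjection.sum (p q : MatrixProjection R) : MatrixProjection R :=
  ⟨p.1 + q.1, (fromBlocks p.2.1 0 0 q.2.1).submatrix finSumFinEquiv.symm finSumFinEquiv.symm,
    isStarProjection_submatrix (isStarProjection_fromBlocks p.2.2 q.2.2) _⟩

theorem MatrixProjection.sum_mvn (p q : MatrixProjection R) :
    MatrixMvN (p.sum q).2.1 (fromBlocks p.2.1 0 0 q.2.1) :=
  MatrixMvN.submatrix (isStarProjection_fromBlocks p.2.2 q.2.2) _

variable (R) in
/-- The set `V(R)` of Murray–von Neumann classes of projections in matrix algebras over `R`. -/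
def ProjectionMonoid : Type _ := Quotient (matrixProjectionSetoid R)

namespace ProjectionMonoid

/-- The class of a matrix projection in `V(R)`. -/
def mk (p : MatrixProjection R) : ProjectionMonoid R := Quotient.mk _ p

theorem mk_eq {p q : MatrixProjection R} (h : MatrixMvN p.2.1 q.2.1) : mk p = mk q :=
  Quotient.sound h

/-- Addition in `V(R)` is induced by block sum. -/
instance : Add (ProjectionMonoid R) where
  add := Quotient.map₂ MatrixProjection.sum fun p p' hp q q' hq =>
    ((p.sum_mvn q).trans (p.sum q).2.2 (isStarProjection_fromBlocks p'.2.2 q'.2.2)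
      (MatrixMvN.fromBlocks hp hq)).trans (p.sum q).2.2 (p'.sum q').2.2 (p'.sum_mvn q').symm

/-- The zero of `V(R)` is the class of the empty matrix. -/
instance : Zero (ProjectionMonoid R) where
  zero := mk ⟨0, 0, .zero _⟩

theorem mk_add_mk (p q : MatrixProjection R) : mk p + mk q = mk (p.sum q) := rfl

theorem zero_def : (0 : ProjectionMonoid R) = mk ⟨0, 0, .zero _⟩ := rfl

theorem add_comm' (x y : ProjectionMonoid R) : x + y = y + x := by
  induction x using Quotient.inductionOn with | _ p
  induction y using Quotient.inductionOn with | _ q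
  refine mk_eq ((p.sum_mvn q).trans (p.sum q).2.2 (q.sum p).2.2
    (MatrixMvN.trans (q := fromBlocks q.2.1 0 0 p.2.1)
      (isStarProjection_fromBlocks p.2.2 q.2.2) (q.sum p).2.2 ?_ (q.sum_mvn p).symm))
  have h := (MatrixMvN.submatrix (isStarProjection_fromBlocks q.2.2 p.2.2)
    (Equiv.sumComm (Fin p.1) (Fin q.1)))
  simpa using h

theorem add_assoc' (x y z : ProjectionMonoid R) : x + y + z = x + (y + z) := by
  induction x using Quotient.inductionOn with | _ p
  induction y using Quotient.inductionOn with | _ q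
  induction z using Quotient.inductionOn with | _ r
  have hl : MatrixMvN ((p.sum q).sum r).2.1
      (fromBlocks (fromBlocks p.2.1 0 0 q.2.1) 0 0 r.2.1) :=
    (MatrixProjection.sum_mvn _ _).trans ((p.sum q).sum r).2.2
      (isStarProjection_fromBlocks (isStarProjection_fromBlocks p.2.2 q.2.2) r.2.2)
      (MatrixMvN.fromBlocks (p.sum_mvn q) (.refl r.2.2))
  have hr : MatrixMvN (p.sum (q.sum r)).2.1
      (fromBlocks p.2.1 0 0 (fromBlocks q.2.1 0 0 r.2.1)) :=
    (MatrixProjection.sum_mvn _ _).trans (p.sum (q.sum r)).2.2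
      (isStarProjection_fromBlocks p.2.2 (isStarProjection_fromBlocks q.2.2 r.2.2))
      (MatrixMvN.fromBlocks (.refl p.2.2) (q.sum_mvn r))
  have hm := MatrixMvN.submatrix
    (isStarProjection_fromBlocks p.2.2 (isStarProjection_fromBlocks q.2.2 r.2.2))
    (Equiv.sumAssoc (Fin p.1) (Fin q.1) (Fin r.1))
  have he : (fromBlocks p.2.1 0 0 (fromBlocks q.2.1 0 0 r.2.1)).submatrix
      (Equiv.sumAssoc (Fin p.1) (Fin q.1) (Fin r.1)) (Equiv.sumAssoc (Fin p.1) (Fin q.1) (Fin r.1))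
      = fromBlocks (fromBlocks p.2.1 0 0 q.2.1) 0 0 r.2.1 := by
    ext i j
    rcases i with (i | i) | i <;> rcases j with (j | j) | j <;> simp
  rw [he] at hm
  exact mk_eq (hl.trans ((p.sum q).sum r).2.2 (p.sum (q.sum r)).2.2
    (hm.trans (isStarProjection_fromBlocks (isStarProjection_fromBlocks p.2.2 q.2.2) r.2.2)
      (p.sum (q.sum r)).2.2 hr.symm))

theorem zero_add' (x : ProjectionMonoid R) : 0 + x = x := by
  induction x using Quotient.inductionOn with | _ p
  refine mk_eq ((MatrixProjection.sum_mvn _ _).trans (MatrixProjection.sum _ _).2.2 p.2.2 ?_)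
  have h := MatrixMvN.submatrix
    (isStarProjection_fromBlocks (IsStarProjection.zero (Matrix (Fin 0) (Fin 0) R)) p.2.2)
    (Equiv.emptySum (Fin 0) (Fin p.1)).symm
  have he : (fromBlocks (0 : Matrix (Fin 0) (Fin 0) R) 0 0 p.2.1).submatrix
      (Equiv.emptySum (Fin 0) (Fin p.1)).symm (Equiv.emptySum (Fin 0) (Fin p.1)).symm = p.2.1 := by
    ext i j; simp
  rw [he] at h
  exact h.symm

instance : AddCommMonoid (ProjectionMonoid R) where
  add_assoc := add_assoc'
  add_comm := add_comm'
  zero_add := zero_add'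
  add_zero x := (add_comm' x 0).trans (zero_add' x)
  nsmul := nsmulRec

theorem isStarProjection_map (f : R →⋆ₙ+* S) {p : Matrix ι ι R} (hp : IsStarProjection p) :
    IsStarProjection (p.map f) :=
  isStarProjection_of
    (by rw [← Matrix.map_mul, mul_self_of_isStarProjection hp])
    (by rw [← conjTranspose_map _ (map_star f), conjTranspose_of_isStarProjection hp])

/-- The homomorphism `V(R) → V(S)` induced by a ⋆-homomorphism `R → S`, applied entrywise. -/
def map (f : R →⋆ₙ+* S) : ProjectionMonoid R →+ ProjectionMonoid S where
  toFun := Quotient.map (fun p => ⟨p.1, p.2.1.map f, isStarProjection_map f p.2.2⟩) <| by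
    rintro p q ⟨v, h₁, h₂⟩
    have hv : (v.map f)ᴴ = vᴴ.map f := (conjTranspose_map _ (map_star f)).symm
    exact ⟨v.map f, by rw [hv, ← Matrix.map_mul, h₁], by rw [hv, ← Matrix.map_mul, h₂]⟩
  map_zero' := congrArg mk (by
    refine Sigma.ext rfl (heq_of_eq (Subtype.ext ?_))
    ext i; exact i.elim0)
  map_add' x y := by
    induction x using Quotient.inductionOn with | _ p
    induction y using Quotient.inductionOn with | _ q
    refine congrArg mk (Sigma.ext rfl (heq_of_eq (Subtype.ext ?_)))
    simp [MatrixProjection.sum, fromBlocks_map, ← submatrix_map]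

end ProjectionMonoid

open Algebra

variable (R) in
/-- `K₀` of a unital ring with involution: the Grothendieck group of `V(R)`. -/
abbrev K0 : Type _ := GrothendieckAddGroup (ProjectionMonoid R)

/-- The homomorphism on `K₀` induced by a ⋆-homomorphism. -/
noncomputable def K0.map (f : R →⋆ₙ+* S) : K0 R →+ K0 S :=
  GrothendieckAddGroup.lift (GrothendieckAddGroup.of.comp (ProjectionMonoid.map f))

variable (A : Type*) [RealCStarAlgebra A]

/-- The canonical projection `A⁺ → ℝ` with kernel `A`. -/
def unitizationFst : Unitization ℝ A →⋆ₙ+* ℝ where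
  toFun x := x.fst
  map_mul' := Unitization.fst_mul
  map_zero' := Unitization.fst_zero
  map_add' := Unitization.fst_add
  map_star' := Unitization.fst_star

/-- `KO₀(A)`: the kernel of `K₀(A⁺) → K₀(ℝ)`, where `A⁺` is the unitization of `A`. -/
noncomputable def KO0 : AddSubgroup (K0 (Unitization ℝ A)) :=
  (K0.map (unitizationFst A)).ker

variable {A}

/-- A projection `p` of `A`, viewed as a `1 × 1` matrix over the unitization. -/
def unitizationProjection (p : A) (hp : IsStarProjection p) :
    MatrixProjection (Unitization ℝ A) :=
  ⟨1, Matrix.of fun _ _ => (p : Unitization ℝ A), isStarProjection_of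
    (by ext i j <;> simp [Matrix.mul_apply, ← Unitization.inr_mul, hp.isIdempotentElem.eq])
    (by ext i j <;> simp [← Unitization.inr_star, hp.isSelfAdjoint.star_eq])⟩

/-- The class in `KO₀(A)` of a projection `p` of `A`. -/
noncomputable def KO0.ofProjection (p : A) (hp : IsStarProjection p) : KO0 A :=
  ⟨GrothendieckAddGroup.of (ProjectionMonoid.mk (unitizationProjection p hp)), by
    have h : ProjectionMonoid.map (unitizationFst A)
        (ProjectionMonoid.mk (unitizationProjection p hp)) = 0 := by
      have h0 : (unitizationProjection p hp).2.1.map (unitizationFst A) = 0 := by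
        ext i j
        rfl
      exact ProjectionMonoid.mk_eq ⟨0, by simp [h0], by simp⟩
    rw [KO0, AddMonoidHom.mem_ker, K0.map]
    simp [GrothendieckAddGroup.lift, h]⟩

end KTheory

end RealCStar

/-! Write `B` for the unitization of `A` and `f : B → ℝ` for its character with kernel `A`. The
proof has an analytic half and an algebraic half.

Analysis: the axiom that `1 + a⋆a` is invertible replaces complex spectral theory. It passes to `B`,
then to sums of squares and to matrices over `B`. With a power series for `(1 - x)^(-1/2)` this
gives polar decomposition of left-invertible matrices (`exists_polar`). Hence algebraically
equivalent projections are Murray–von Neumann equivalent, and approximations can be corrected to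
exact partial isometries.

Pure infiniteness and simplicity enter through one factorization: for a nonzero projection `q` of
`A`, every matrix over `A` is a limit of single products `b c`, with `b` a column over `Bq` and `c`
a row over `qB` (`mem_closure_columnRow`). Finite sums collapse to one product because `q` dominates
two orthogonal copies of itself. Consequently every matrix projection over `A` is equivalent to a
proper subprojection of `q`. So in the set `S` of classes of nonzero projections of `A` each
equation `a + x = b` is solvable, and `S` is a group inside the monoid `V(B)`.

Injectivity: if `x, y ∈ S` agree in `K₀(B)`, write `x = y + z` with `z ∈ S`. Then `z + [1ₙ] = [1ₙ]`
for some `n`, so `z` is the defect of an isometry `V`, which may be taken to be `1` modulo `A`.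
Replacing `V` by `1 + bc` and exchanging the factors, `1 + bc ↦ q + cb`, moves the defect into the
corner of `q`, where it is absorbed (`exists_add_eq_self_of_isometry`). Hence `z` is neutral in `S`.

Surjectivity: after stabilizing, an element of the kernel is represented by a projection `P` that is
equivalent to `1ₖ` modulo `A`. The factorization embeds `P` in `1ₖ ⊕ q` with complement `r` over
`A`, and solving `[r] + u = [q]` in `S` yields the element as `u`. -/

namespace RealCStar

/-! ### Inverse square roots in real Banach ⋆-algebras -/

section BanachAlgebra

open Filter Topology
open scoped NNReal ENNReal

variable {M : Type*} [NormedRing M] [NormedAlgebra ℝ M]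

variable (M) in
/-- The representation of a real Banach algebra on the complex Banach space of its `ℂ`-valued
functionals, `(b φ)(x) = φ(x b)`. -/
noncomputable def dualRep : M →+* ((M →L[ℝ] ℂ) →L[ℂ] (M →L[ℝ] ℂ)) where
  toFun b := LinearMap.mkContinuous
    { toFun := fun φ => φ.comp ((ContinuousLinearMap.mul ℝ M).flip b)
      map_add' := fun _ _ => rfl
      map_smul' := fun _ _ => rfl } ‖(ContinuousLinearMap.mul ℝ M).flip b‖ fun φ => by
        rw [mul_comm]; exact φ.opNorm_comp_le _
  map_one' := ContinuousLinearMap.ext fun φ => ContinuousLinearMap.ext fun x =>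
    congrArg φ (mul_one x)
  map_mul' b c := ContinuousLinearMap.ext fun φ => ContinuousLinearMap.ext fun x =>
    congrArg φ (mul_assoc x b c).symm
  map_zero' := ContinuousLinearMap.ext fun φ => ContinuousLinearMap.ext fun x =>
    (congrArg φ (mul_zero x)).trans (map_zero φ)
  map_add' b c := ContinuousLinearMap.ext fun φ => ContinuousLinearMap.ext fun x =>
    (congrArg φ (mul_add x b c)).trans (map_add φ _ _)

theorem dualRep_apply (b : M) (φ : M →L[ℝ] ℂ) (x : M) : dualRep M b φ x = φ (x * b) := rfl

theorem dualRep_algebraMap (s : ℝ) : dualRep M (algebraMap ℝ M s) = (s : ℂ) • 1 := by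
  refine ContinuousLinearMap.ext fun φ => ContinuousLinearMap.ext fun x => ?_
  rw [dualRep_apply, ← Algebra.commutes, ← Algebra.smul_def, map_smul]
  rfl

/-- Evaluate at `1` the image of a norming functional of `b`. Thus `dualRep` embeds a real algebra
in a complex one without choosing a norm on the complexification; the factor `‖1‖` is there because
`‖1‖ = 1` is not assumed. -/
theorem norm_le_norm_dualRep (b : M) : ‖b‖ ≤ ‖dualRep M b‖ * ‖(1 : M)‖ := by
  obtain ⟨g, hg, hgb⟩ := exists_dual_vector'' ℝ b
  have h1 : ‖Complex.ofRealCLM.comp g‖ ≤ 1 := by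
    refine (ContinuousLinearMap.opNorm_comp_le _ _).trans ?_
    simpa using hg
  have h2 : ‖dualRep M b (Complex.ofRealCLM.comp g) 1‖ = ‖b‖ := by
    rw [dualRep_apply, one_mul]
    simp [hgb]
  calc ‖b‖ = ‖dualRep M b (Complex.ofRealCLM.comp g) 1‖ := h2.symm
    _ ≤ ‖dualRep M b (Complex.ofRealCLM.comp g)‖ * ‖(1 : M)‖ := ContinuousLinearMap.le_opNorm _ _
    _ ≤ ‖dualRep M b‖ * 1 * ‖(1 : M)‖ := by
      gcongr
      exact (ContinuousLinearMap.le_opNorm _ _).trans (by gcongr)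
    _ = _ := by rw [mul_one]

/-- Difference of squares with commuting factors. With `c` the imaginary part `i t`, it turns
invertibility of the real quadratic `(x - s)² + t²` into invertibility of `s + i t - x`. -/
theorem isUnit_of_isUnit_sq_add_neg_sq {S : Type*} [Ring S] {y a c : S} (hca : c * a = a * c)
    (hcy : c * y = y * c) (hu : IsUnit ((y - a) ^ 2 + -c ^ 2)) : IsUnit (a + c - y) := by
  have hc : (a + c - y) * (a - c - y) = (a - c - y) * (a + c - y) := by
    simp only [mul_sub, sub_mul, add_mul, mul_add, hca, hcy]
    abel
  have hprod : (y - a) ^ 2 + -c ^ 2 = (a + c - y) * (a - c - y) := by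
    simp only [pow_two, mul_sub, sub_mul, add_mul, hca, hcy]
    abel
  rw [hprod] at hu
  exact ((show Commute _ _ from hc).isUnit_mul_iff.1 hu).1

/-- The hypotheses exclude from the spectrum of `f x` the nonreal points (`hq`) and the real points
outside `(-1, 1)` (`hr`). The spectral radius is therefore below `1`, and Gelfand's formula gives
geometric decay, which `hK` pulls back to `M`. -/
theorem summable_norm_pow_of_ringHom {S : Type*} [NormedRing S] [NormedAlgebra ℂ S]
    [CompleteSpace S] (f : M →+* S) (hf' : ∀ s : ℝ, f (algebraMap ℝ M s) = (s : ℂ) • 1)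
    {K : ℝ} (hK : ∀ b, ‖b‖ ≤ ‖f b‖ * K) {x : M}
    (hq : ∀ s t : ℝ, t ≠ 0 → IsUnit ((x - algebraMap ℝ M s) ^ 2 + algebraMap ℝ M (t ^ 2)))
    (hr : ∀ s : ℝ, 1 ≤ |s| → IsUnit (algebraMap ℝ M s - x)) : Summable fun n => ‖x ^ n‖ := by
  have hf : ∀ s : ℝ, f (algebraMap ℝ M s) = algebraMap ℂ S (s : ℂ) := fun s => by
    rw [hf', Algebra.algebraMap_eq_smul_one]
  rcases subsingleton_or_nontrivial M with hM | hM
  · have : (fun n => ‖x ^ n‖) = fun _ => 0 := by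
      ext n; rw [Subsingleton.elim (x ^ n) 0, norm_zero]
    rw [this]; exact summable_zero
  have hnt : Nontrivial S := by
    refine ⟨⟨1, 0, fun h => ?_⟩⟩
    have := hK (1 : M)
    rw [map_one, h, norm_zero, zero_mul] at this
    exact one_ne_zero (norm_le_zero_iff.1 this)
  have hspec : ∀ z ∈ spectrum ℂ (f x), ‖z‖₊ < 1 := by
    intro z hz
    by_contra hlt
    rw [not_lt] at hlt
    apply hz
    show IsUnit (algebraMap ℂ _ z - f x)
    by_cases him : z.im = 0
    · have hz' : z = (z.re : ℂ) := Complex.ext rfl (by simp [him])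
      rw [hz', ← hf, ← RingHom.map_sub]
      refine (hr _ ?_).map _
      have : (1 : ℝ) ≤ ‖z‖ := hlt
      rw [hz', Complex.norm_real] at this
      exact this
    · have hu := (hq z.re z.im him).map f
      rw [map_add, map_pow, map_sub, hf, hf] at hu
      have e1 : algebraMap ℂ S z
          = algebraMap ℂ _ (z.re : ℂ) + algebraMap ℂ _ ((z.im : ℂ) * Complex.I) := by
        rw [← map_add, Complex.re_add_im]
      have e2 : algebraMap ℂ S ((z.im ^ 2 : ℝ) : ℂ)
          = -(algebraMap ℂ _ ((z.im : ℂ) * Complex.I)) ^ 2 := by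
        rw [← map_pow, mul_pow, Complex.I_sq, ← map_neg]
        push_cast; simp
      rw [e2] at hu
      rw [e1]
      exact isUnit_of_isUnit_sq_add_neg_sq (Algebra.commutes _ _) (Algebra.commutes _ _) hu
  have hrad : spectralRadius ℂ (f x) < ((1 : ℝ≥0) : ℝ≥0∞) :=
    spectrum.spectralRadius_lt_of_forall_lt _ hspec
  obtain ⟨r, hr1, hr2⟩ := ENNReal.lt_iff_exists_nnreal_btwn.1 hrad
  have hr2' : r < 1 := by exact_mod_cast hr2
  have hev := (spectrum.pow_nnnorm_pow_one_div_tendsto_nhds_spectralRadius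
    (f x)).eventually_lt_const hr1
  have hbound : ∀ᶠ n : ℕ in atTop, ‖(‖x ^ n‖)‖ ≤ K * (r : ℝ) ^ n := by
    filter_upwards [hev, eventually_gt_atTop 0] with n hn hn0
    have hn0' : (n : ℝ) ≠ 0 := by exact_mod_cast hn0.ne'
    have h1 : (‖f x ^ n‖₊ : ℝ≥0∞) ≤ (r : ℝ≥0∞) ^ n := by
      have := ENNReal.rpow_le_rpow hn.le (Nat.cast_nonneg n : (0 : ℝ) ≤ n)
      rw [← ENNReal.rpow_mul, one_div_mul_cancel hn0', ENNReal.rpow_one,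
        ENNReal.rpow_natCast] at this
      exact this
    have h2 : ‖f x ^ n‖ ≤ (r : ℝ) ^ n := by exact_mod_cast h1
    rw [norm_norm, mul_comm]
    refine (hK _).trans ?_
    rw [map_pow]
    have hK0 : 0 ≤ K := by
      by_contra hneg
      have h3 := hK 1
      have h4 : 0 < ‖(1 : M)‖ := norm_pos_iff.2 one_ne_zero
      nlinarith [norm_nonneg (f 1)]
    gcongr
  exact Summable.of_norm_bounded_eventually_nat
    ((summable_geometric_of_lt_one r.2 hr2').mul_left _) hbound

theorem summable_norm_pow_of_isUnit [CompleteSpace M] {x : M}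
    (hq : ∀ s t : ℝ, t ≠ 0 → IsUnit ((x - algebraMap ℝ M s) ^ 2 + algebraMap ℝ M (t ^ 2)))
    (hr : ∀ s : ℝ, 1 ≤ |s| → IsUnit (algebraMap ℝ M s - x)) : Summable fun n => ‖x ^ n‖ :=
  summable_norm_pow_of_ringHom (S := (M →L[ℝ] ℂ) →L[ℂ] (M →L[ℝ] ℂ)) (dualRep M)
    (fun s => dualRep_algebraMap s) (K := ‖(1 : M)‖) (fun b => norm_le_norm_dualRep b) hq hr

/-- The coefficients of the power series of `(1 - x)^(-1/2)`. -/
noncomputable def invSqrtCoeff (n : ℕ) : ℝ := Ring.multichoose (1 / 2 : ℝ) n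

theorem invSqrtCoeff_nonneg (n : ℕ) : 0 ≤ invSqrtCoeff n := by
  have h := Ring.factorial_nsmul_multichoose_eq_ascPochhammer (1 / 2 : ℝ) n
  rw [Polynomial.ascPochhammer_smeval_eq_eval, nsmul_eq_mul] at h
  have h2 : 0 < (ascPochhammer ℝ n).eval (1 / 2 : ℝ) := ascPochhammer_pos n _ (by norm_num)
  rw [← h] at h2
  exact (pos_of_mul_pos_right h2 (Nat.cast_nonneg _)).le

/-- The Chu–Vandermonde identity for the exponent `-1 = -1/2 - 1/2`: the square of the series is the
geometric series. -/
theorem sum_antidiagonal_invSqrtCoeff (n : ℕ) :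
    ∑ ij ∈ Finset.HasAntidiagonal.antidiagonal n, invSqrtCoeff ij.1 * invSqrtCoeff ij.2 = 1 := by
  have hneg : ∀ (r : ℝ) (k : ℕ), Ring.multichoose r k = (-1) ^ k * Ring.choose (-r) k := by
    intro r k
    rw [Ring.choose_neg', Int.negOnePow_def, Units.smul_def, zsmul_eq_mul, ← mul_assoc]
    rcases Nat.even_or_odd k with hk | hk <;> simp [hk.neg_one_pow]
  have h := Ring.add_choose_eq n (Commute.all (-(1 / 2) : ℝ) (-(1 / 2) : ℝ))
  have h1 := hneg 1 n
  rw [Ring.multichoose_one, show (-1 : ℝ) = -(1/2) + -(1/2) by norm_num, h, Finset.mul_sum] at h1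
  rw [h1]
  refine Finset.sum_congr rfl fun ij hij => ?_
  rw [invSqrtCoeff, invSqrtCoeff, hneg, hneg, ← Finset.HasAntidiagonal.mem_antidiagonal.1 hij, pow_add]
  norm_num
  ring

theorem invSqrtCoeff_le_one (n : ℕ) : invSqrtCoeff n ≤ 1 := by
  have h0 : invSqrtCoeff 0 = 1 := by simp [invSqrtCoeff]
  have h := sum_antidiagonal_invSqrtCoeff n
  have h1 : invSqrtCoeff 0 * invSqrtCoeff n
      ≤ ∑ ij ∈ Finset.HasAntidiagonal.antidiagonal n, invSqrtCoeff ij.1 * invSqrtCoeff ij.2 :=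
    Finset.single_le_sum (f := fun ij : ℕ × ℕ => invSqrtCoeff ij.1 * invSqrtCoeff ij.2)
      (fun ij _ => mul_nonneg (invSqrtCoeff_nonneg _) (invSqrtCoeff_nonneg _))
      (a := (0, n)) (by simp)
  rw [h, h0, one_mul] at h1
  exact h1

theorem exists_mul_self_mul_one_sub_eq_one [CompleteSpace M] [StarRing M] [ContinuousStar M]
    [StarModule ℝ M] {x : M} (hx : star x = x) (hs : Summable fun n => ‖x ^ n‖) :
    ∃ h : M, star h = h ∧ h * h * (1 - x) = 1 ∧ ∀ y, Commute y x → Commute y h := by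
  have hs' : Summable fun n => ‖invSqrtCoeff n • x ^ n‖ := by
    refine Summable.of_nonneg_of_le (fun _ => norm_nonneg _) (fun n => ?_) hs
    rw [norm_smul, Real.norm_of_nonneg (invSqrtCoeff_nonneg n)]
    exact mul_le_of_le_one_left (norm_nonneg _) (invSqrtCoeff_le_one n)
  refine ⟨∑' n, invSqrtCoeff n • x ^ n, ?_, ?_, fun y hy => ?_⟩
  · rw [tsum_star]
    simp only [star_smul, star_pow, hx, star_trivial]
  · rw [tsum_mul_tsum_eq_tsum_sum_antidiagonal_of_summable_norm hs' hs']
    have : ∀ n, ∑ kl ∈ Finset.HasAntidiagonal.antidiagonal n,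
        invSqrtCoeff kl.1 • x ^ kl.1 * invSqrtCoeff kl.2 • x ^ kl.2 = x ^ n := by
      intro n
      calc _ = ∑ kl ∈ Finset.HasAntidiagonal.antidiagonal n, (invSqrtCoeff kl.1 * invSqrtCoeff kl.2) • x ^ n := by
            refine Finset.sum_congr rfl fun kl h => ?_
            rw [smul_mul_smul_comm, ← pow_add, Finset.HasAntidiagonal.mem_antidiagonal.1 h]
        _ = x ^ n := by rw [← Finset.sum_smul, sum_antidiagonal_invSqrtCoeff, one_smul]
    simp_rw [this]
    have hsum := hs.of_norm
    have h1 := hsum.tsum_eq_zero_add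
    simp_rw [pow_succ, pow_zero] at h1
    rw [hsum.tsum_mul_right] at h1
    rw [mul_sub, mul_one, sub_eq_iff_eq_add]
    exact h1
  · exact Commute.tsum_right _ fun n => (hy.pow_right n).smul_right _

theorem isUnit_sub_sq_add_sq [StarRing M] [StarModule ℝ M] (hM : ∀ x : M, IsUnit (1 + star x * x))
    {x : M} (hx : star x = x) (s t : ℝ) (ht : t ≠ 0) :
    IsUnit ((x - algebraMap ℝ M s) ^ 2 + algebraMap ℝ M (t ^ 2)) := by
  set k := x - algebraMap ℝ M s
  have hk : star k = k := by simp [k, hx, Algebra.algebraMap_eq_smul_one, star_smul]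
  have h1 := (isUnit_smul_iff (Units.mk0 (t ^ 2) (by positivity)) _).2 (hM (t⁻¹ • k))
  rw [Units.smul_mk0, star_smul, hk, smul_mul_smul_comm, star_trivial, smul_add, smul_smul] at h1
  rw [Algebra.algebraMap_eq_smul_one, add_comm, pow_two k]
  convert h1 using 2
  rw [show t ^ 2 * (t⁻¹ * t⁻¹) = 1 by field_simp, one_smul]

/-- No C⋆-identity is assumed, so the result applies to matrix algebras under any complete algebra
norm with continuous star. -/
theorem exists_inv_sqrt [CompleteSpace M] [StarRing M] [ContinuousStar M] [StarModule ℝ M]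
    (hM : ∀ x : M, IsUnit (1 + star x * x)) {w : M} (hw : star w = w)
    (hpos : ∀ s : ℝ, 0 ≤ s → IsUnit (algebraMap ℝ M s + w)) :
    ∃ h : M, star h = h ∧ h * h * w = 1 ∧ ∀ y, Commute y w → Commute y h := by
  have hsm : ∀ (c : ℝ) (z : M), c ≠ 0 → (IsUnit (c • z) ↔ IsUnit z) := by
    intro c z hc
    exact isUnit_smul_iff (Units.mk0 c hc) z
  set C : ℝ := ‖w‖ + 1
  have hC : 0 < C := by positivity
  have hCw : ‖C⁻¹ • w‖ < 1 := by
    rw [norm_smul, norm_inv, Real.norm_of_nonneg hC.le, inv_mul_lt_iff₀ hC]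
    simp [C]
  -- Rescaling by `C > ‖w‖` puts the real spectrum of `x` inside `(-1, 1)`: real points `s ≥ 1` are
  -- excluded by `hpos`, and points `s ≤ -1` by a Neumann series.
  obtain ⟨h, h1, h2, h3⟩ := exists_mul_self_mul_one_sub_eq_one (x := 1 - C⁻¹ • w)
    (by simp [star_smul, hw]) (summable_norm_pow_of_isUnit
      (isUnit_sub_sq_add_sq hM (by simp [star_smul, hw])) (fun s hs => by
      rcases le_abs.1 hs with hs | hs
      · rw [← hsm C _ hC.ne']
        convert hpos (C * (s - 1)) (mul_nonneg hC.le (by linarith)) using 1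
        simp only [Algebra.algebraMap_eq_smul_one, smul_sub, smul_smul, mul_sub, sub_smul,
          mul_one, mul_inv_cancel₀ hC.ne', one_smul]
        abel
      · have hs' : (1 - s) ≠ 0 := by linarith
        rw [← hsm (-(1 - s)⁻¹) _ (by simpa using hs')]
        convert isUnit_one_sub_of_norm_lt_one (x := (1 - s)⁻¹ • C⁻¹ • w) ?_ using 1
        · have h1 : (1 : M) = (1 - s)⁻¹ • (1 - s) • (1 : M) := by
            rw [smul_smul, inv_mul_cancel₀ hs', one_smul]
          rw [Algebra.algebraMap_eq_smul_one, neg_smul, ← smul_neg]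
          nth_rewrite 3 [h1]
          rw [← smul_sub]
          congr 1
          rw [sub_smul, one_smul]
          abel
        · rw [norm_smul, norm_inv, Real.norm_of_nonneg (by linarith)]
          have : (1 - s)⁻¹ ≤ 1 := inv_le_one_of_one_le₀ (by linarith)
          nlinarith [norm_nonneg (C⁻¹ • w)]))
  rw [sub_sub_cancel] at h2
  refine ⟨(Real.sqrt C)⁻¹ • h, by rw [star_smul, h1, star_trivial], ?_, fun y hy => ?_⟩
  · rw [smul_mul_smul_comm, ← mul_inv, Real.mul_self_sqrt hC.le, smul_mul_assoc, ← mul_smul_comm]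
    exact h2
  · exact (h3 y ((Commute.one_right y).sub_right (hy.smul_right _))).smul_right _

end BanachAlgebra

/-- A unital real C⋆-algebra. -/
class UnitalRealCStarAlgebra (B : Type*) extends NormedRing B, StarRing B, CStarRing B,
    NormedAlgebra ℝ B, StarModule ℝ B, CompleteSpace B where
  isUnit_one_add_star_mul_self : ∀ b : B, IsUnit (1 + star b * b)

/-! ### Positivity of sums of squares -/

section Positivity

theorem isUnit_smul_iff_of_ne_zero {R : Type*} [Ring R] [Algebra ℝ R] {c : ℝ} (hc : c ≠ 0)
    {z : R} : IsUnit (c • z) ↔ IsUnit z :=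
  isUnit_smul_iff (Units.mk0 c hc) z

theorem isUnit_algebraMap_add_star_mul_self_of_isUnit {R : Type*} [Ring R] [StarRing R]
    [Algebra ℝ R] [StarModule ℝ R] {b : R} {s : ℝ} (hs : 0 < s)
    (h : IsUnit (1 + star ((Real.sqrt s)⁻¹ • b) * ((Real.sqrt s)⁻¹ • b))) :
    IsUnit (algebraMap ℝ R s + star b * b) := by
  rw [← isUnit_smul_iff_of_ne_zero hs.ne', star_smul, star_trivial, smul_mul_smul_comm, ← mul_inv,
    Real.mul_self_sqrt hs.le, smul_add, smul_smul, mul_inv_cancel₀ hs.ne', one_smul] at h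
  rwa [Algebra.algebraMap_eq_smul_one]

theorem star_algebraMap_real {R : Type*} [Ring R] [StarRing R] [Algebra ℝ R] [StarModule ℝ R]
    (s : ℝ) : star (algebraMap ℝ R s) = algebraMap ℝ R s := by
  simp [Algebra.algebraMap_eq_smul_one, star_smul]

open Polynomial in
/-- If `1 + a⋆a` is invertible for all `a` in the kernel of a real character, then it is so for
all `a`. -/
theorem isUnit_one_add_star_mul_self_of_ker {R : Type*} [Ring R] [StarRing R]
    [Algebra ℝ R] [StarModule ℝ R] (f : R →ₐ[ℝ] ℝ) (hf : ∀ x, f (star x) = f x)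
    (h : ∀ a, f a = 0 → IsUnit (1 + star a * a)) (b : R) : IsUnit (1 + star b * b) := by
  set m : ℝ := f b ^ 2
  set u := star b * b
  set k := u - algebraMap ℝ R m
  have hk : star k = k := by
    simp [k, u, star_algebraMap_real]
  have hfst : f (b * k) = 0 := by
    simp [k, u, m, hf, pow_two]
  set d := (1 + m) ^ 2
  have hd : 0 < d := by
    have : 0 ≤ m := sq_nonneg _
    positivity
  have h2 : IsUnit (algebraMap ℝ R d + k * u * k) := by
    have h3 := isUnit_algebraMap_add_star_mul_self_of_isUnit (b := b * k) hd
      (h _ (by rw [map_smul, hfst, smul_zero]))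
    rw [star_mul, hk] at h3
    convert h3 using 2
    simp only [u, mul_assoc]
  have hid : ((1 + C m) ^ 2 + (X - C m) * X * (X - C m) : ℝ[X])
      = (1 + X) * (X ^ 2 - (2 * C m + 1) * X + (1 + C m) ^ 2) := by ring
  have h4 := congrArg (aeval u) hid
  have h5 : aeval u ((1 + C m) ^ 2 + (X - C m) * X * (X - C m) : ℝ[X])
      = algebraMap ℝ R d + k * u * k := by
    simp only [map_add, map_pow, map_one, map_mul, map_sub, aeval_X, aeval_C, k, d]
  rw [h5, map_mul (aeval u) (1 + X)] at h4
  rw [h4] at h2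
  have h6 : Commute (aeval u (1 + X : ℝ[X]))
      (aeval u (X ^ 2 - (2 * C m + 1) * X + (1 + C m) ^ 2 : ℝ[X])) := by
    show _ * _ = _ * _
    rw [← map_mul, mul_comm, map_mul]
  have h7 := (h6.isUnit_mul_iff.1 h2).1
  rwa [map_add, map_one, aeval_X] at h7

theorem isUnit_algebraMap_sub_of_norm_lt {M : Type*} [NormedRing M] [NormedAlgebra ℝ M]
    [CompleteSpace M] {u : M} {c : ℝ} (h : ‖u‖ < c) : IsUnit (algebraMap ℝ M c - u) := by
  have hc : 0 < c := (norm_nonneg u).trans_lt h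
  have h1 : IsUnit (1 - c⁻¹ • u) := isUnit_one_sub_of_norm_lt_one (by
    rwa [norm_smul, norm_inv, Real.norm_of_nonneg hc.le, inv_mul_lt_iff₀ hc, mul_one])
  rw [← isUnit_smul_iff_of_ne_zero hc.ne', smul_sub, smul_smul, mul_inv_cancel₀ hc.ne',
    one_smul] at h1
  rwa [Algebra.algebraMap_eq_smul_one]

variable {B : Type*} [UnitalRealCStarAlgebra B]

theorem isUnit_algebraMap_add_star_mul_self (b : B) {s : ℝ} (hs : 0 < s) :
    IsUnit (algebraMap ℝ B s + star b * b) :=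
  isUnit_algebraMap_add_star_mul_self_of_isUnit hs
    (UnitalRealCStarAlgebra.isUnit_one_add_star_mul_self _)

/-- A norm form of positivity, stable under sums. If `k = ‖b‖² - b⋆b` had norm `N > ‖b‖²`, the
powers of `k / N` would tend to `0`, while the C⋆-identity keeps the norms of its powers of exponent
`2^n` equal to `1`. -/
theorem norm_algebraMap_sub_star_mul_self_le (b : B) :
    ‖algebraMap ℝ (B) (‖b‖ ^ 2) - star b * b‖ ≤ ‖b‖ ^ 2 := by
  by_contra! hlt
  set t := ‖b‖ ^ 2
  have ht : 0 ≤ t := sq_nonneg _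
  set k := algebraMap ℝ (B) t - star b * b
  have hk : star k = k := by simp [k, star_algebraMap_real]
  set N := ‖k‖
  have hN : 0 < N := ht.trans_lt hlt
  have hx : IsSelfAdjoint (N⁻¹ • k) := by
    rw [isSelfAdjoint_iff, star_smul, hk, star_trivial]
  have hsum := summable_norm_pow_of_isUnit (x := N⁻¹ • k)
    (isUnit_sub_sq_add_sq UnitalRealCStarAlgebra.isUnit_one_add_star_mul_self hx) (fun s hs => by
      rw [← isUnit_smul_iff_of_ne_zero hN.ne', smul_sub, smul_smul, mul_inv_cancel₀ hN.ne', one_smul,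
        Algebra.algebraMap_eq_smul_one, smul_smul, ← Algebra.algebraMap_eq_smul_one]
      rcases le_abs.1 hs with hs | hs
      · convert isUnit_algebraMap_add_star_mul_self b (s := N * s - t) (by nlinarith) using 1
        simp only [k, map_sub]
        abel
      · rw [← IsUnit.neg_iff]
        convert isUnit_algebraMap_sub_of_norm_lt (u := star b * b) (c := t - N * s) ?_ using 1
        · simp only [k, map_sub]
          abel
        · rw [CStarRing.norm_star_mul_self, ← pow_two]
          nlinarith)
  have h1 := hsum.tendsto_atTop_zero.comp (tendsto_pow_atTop_atTop_of_one_lt (one_lt_two (α := ℕ)))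
  have h2 : ((fun n => ‖(N⁻¹ • k) ^ n‖) ∘ fun n : ℕ => 2 ^ n) = fun _ => (1 : ℝ) := by
    ext n
    rw [Function.comp_apply, hx.norm_pow_two_pow, norm_smul, norm_inv, Real.norm_of_nonneg hN.le,
      inv_mul_cancel₀ hN.ne', one_pow]
  rw [h2] at h1
  exact one_ne_zero (tendsto_nhds_unique tendsto_const_nhds h1)

theorem isUnit_one_add_sum_star_mul_self {ι : Type*} [Fintype ι] (b : ι → B) :
    IsUnit (1 + ∑ i, star (b i) * b i) := by
  have h := isUnit_algebraMap_sub_of_norm_lt (c := 1 + ∑ i, ‖b i‖ ^ 2)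
    (u := ∑ i, (algebraMap ℝ (B) (‖b i‖ ^ 2) - star (b i) * b i))
    (((norm_sum_le _ _).trans (Finset.sum_le_sum fun i _ =>
      norm_algebraMap_sub_star_mul_self_le (b i))).trans_lt (by linarith))
  convert h using 1
  rw [Finset.sum_sub_distrib, map_add, map_sum, map_one]
  abel

end Positivity

/-! ### Positivity and polar decomposition for matrices -/

section MatrixPositivity

open Matrix

variable {B : Type*} [UnitalRealCStarAlgebra B]
variable {m n : Type*} [Fintype m] [Fintype n] [DecidableEq m] [DecidableEq n]

theorem isUnit_one_add_mul_comm {R : Type*} [Ring R] (a : Matrix m n R) (b : Matrix n m R)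
    (h : IsUnit (1 + b * a)) : IsUnit (1 + a * b) := by
  obtain ⟨⟨u, c, h1, h2⟩, rfl : u = _⟩ := h
  have h1' : c + b * a * c = 1 := by rw [← h1, Matrix.add_mul, Matrix.one_mul]
  have h2' : c + c * (b * a) = 1 := by rw [← h2, Matrix.mul_add, Matrix.mul_one]
  refine ⟨⟨1 + a * b, 1 - a * c * b, ?_, ?_⟩, rfl⟩
  · calc (1 + a * b) * (1 - a * c * b) = 1 + a * b - a * (c + b * a * c) * b := by
          simp only [Matrix.mul_sub, Matrix.add_mul, Matrix.mul_add, Matrix.mul_assoc,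
            Matrix.one_mul, Matrix.mul_one]
      _ = 1 := by rw [h1', Matrix.mul_one, add_sub_cancel_right]
  · calc (1 - a * c * b) * (1 + a * b) = 1 + a * b - a * (c + c * (b * a)) * b := by
          simp only [Matrix.sub_mul, Matrix.add_mul, Matrix.mul_add, Matrix.mul_assoc,
            Matrix.one_mul, Matrix.mul_one]
          abel
      _ = 1 := by rw [h2', Matrix.mul_one, add_sub_cancel_right]

/-- Add one column at a time: `C + t t⋆ = C (1 + C⁻¹ t t⋆)`, and exchanging factors reduces
invertibility to that of the `1 × 1` matrix `1 + t⋆ C⁻¹ t`. -/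
theorem isUnit_one_add_sum_mul_conjTranspose {ι : Type*} (s : Finset ι)
    (t : ι → Matrix m Unit B) : IsUnit (1 + ∑ j ∈ s, t j * (t j)ᴴ) := by
  classical
  induction s using Finset.induction_on with
  | empty => simp
  | insert j s hj ih =>
    obtain ⟨⟨C, D, h1, h2⟩, rfl : C = _⟩ := ih
    set C := 1 + ∑ j ∈ s, t j * (t j)ᴴ with hC
    have hCs : Cᴴ = C := by
      simp [hC, conjTranspose_add, conjTranspose_sum, conjTranspose_mul]
    have hDs : Dᴴ = D := by
      have h3 : Dᴴ * C = 1 := by rw [← hCs, ← conjTranspose_mul, h1, conjTranspose_one]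
      calc Dᴴ = Dᴴ * (C * D) := by rw [h1, Matrix.mul_one]
        _ = D := by rw [← Matrix.mul_assoc, h3, Matrix.one_mul]
    -- With `y = C⁻¹ t`, one has `t⋆ C⁻¹ t = y⋆ C y`. Expanding `C` makes this a sum of terms `b⋆b`
    -- in `B`.
    have key : IsUnit (1 + (t j)ᴴ * (D * t j)) := by
      have h4 : (t j)ᴴ * (D * t j) = (D * t j)ᴴ * C * (D * t j) := by
        rw [conjTranspose_mul, hDs, Matrix.mul_assoc, ← Matrix.mul_assoc C, h1, Matrix.one_mul,
          Matrix.mul_assoc]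
      set y := D * t j
      clear_value y
      have h5 := isUnit_one_add_sum_star_mul_self (ι := m ⊕ s)
        (Sum.elim (fun i => y i ()) (fun l => ((t l)ᴴ * y) () ()))
      have h6 := h5.map (Matrix.scalar Unit)
      convert h6 using 1
      rw [h4, hC]
      ext a b
      simp only [Matrix.mul_add, Matrix.add_mul, Matrix.mul_one, Matrix.mul_sum, Matrix.sum_mul,
        Fintype.sum_sum_type, Sum.elim_inl, Sum.elim_inr, scalar_apply, diagonal_apply_eq,
        Matrix.add_apply, Matrix.sum_apply]
      rw [one_apply_eq, Matrix.mul_apply]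
      simp only [conjTranspose_apply]
      rw [← Finset.sum_coe_sort s]
      congr 2
      refine Finset.sum_congr rfl fun l _ => ?_
      have h7 : yᴴ * (t l * (t l)ᴴ) * y = ((t l)ᴴ * y)ᴴ * ((t l)ᴴ * y) := by
        rw [conjTranspose_mul, conjTranspose_conjTranspose]
        simp only [Matrix.mul_assoc]
      rw [h7, Matrix.mul_apply, Fintype.sum_unique]
      rfl
    have h5 := isUnit_one_add_mul_comm (D * t j) (t j)ᴴ key
    have h6 : IsUnit C := ⟨⟨C, D, h1, h2⟩, rfl⟩
    have h7 := h6.mul h5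
    rw [Finset.sum_insert hj, add_comm (t j * _), ← add_assoc, ← hC]
    convert h7 using 1
    rw [Matrix.mul_add, Matrix.mul_one, ← Matrix.mul_assoc, ← Matrix.mul_assoc, h1, Matrix.one_mul]

theorem isUnit_one_add_mul_conjTranspose (T : Matrix m n B) :
    IsUnit (1 + T * Tᴴ) := by
  have h := isUnit_one_add_sum_mul_conjTranspose Finset.univ
    (fun j : n => T.submatrix id (fun _ : Unit => j))
  convert h using 2
  ext a b
  simp [Matrix.mul_apply, Matrix.sum_apply]

theorem isUnit_one_add_conjTranspose_mul (T : Matrix m n B) :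
    IsUnit (1 + Tᴴ * T) := by
  simpa using isUnit_one_add_mul_conjTranspose Tᴴ

/-- For the idempotent `G = V X`, the square of `G + G⋆ - 1` is `1 + (G - G⋆)(G - G⋆)⋆`, hence
invertible. Since `(G + G⋆ - 1) V = X⋆ (V⋆ V)`, inverting it gives a left inverse of `V⋆ V`, and
self-adjointness gives the right inverse. -/
theorem isUnit_conjTranspose_mul_self {V : Matrix m n (B)}
    {X : Matrix n m (B)} (h : X * V = 1) : IsUnit (Vᴴ * V) := by
  set G := V * X
  have hGG : G * G = G := by
    simp only [G, Matrix.mul_assoc]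
    rw [← Matrix.mul_assoc X, h, Matrix.one_mul]
  have hGG' : Gᴴ * Gᴴ = Gᴴ := by rw [← conjTranspose_mul, hGG]
  have hy : IsUnit ((G + Gᴴ - 1) ^ 2) := by
    convert isUnit_one_add_mul_conjTranspose (G - Gᴴ) using 1
    simp only [pow_two, conjTranspose_sub, conjTranspose_conjTranspose, Matrix.mul_sub,
      Matrix.sub_mul, Matrix.mul_add, Matrix.add_mul, hGG, hGG', Matrix.mul_one, Matrix.one_mul]
    abel
  obtain ⟨⟨y, z, hyz, hzy⟩, hy' : y = _⟩ := (isUnit_pow_iff two_ne_zero).1 hy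
  have hyV : y * V = Xᴴ * (Vᴴ * V) := by
    rw [hy', Matrix.sub_mul, Matrix.add_mul, Matrix.one_mul]
    have : G * V = V := by simp only [G, Matrix.mul_assoc, h, Matrix.mul_one]
    rw [this, add_sub_cancel_left]
    simp only [G, conjTranspose_mul, Matrix.mul_assoc]
  have hl : X * z * Xᴴ * (Vᴴ * V) = 1 := by
    rw [Matrix.mul_assoc, ← hyV, Matrix.mul_assoc, ← Matrix.mul_assoc z, hzy, Matrix.one_mul, h]
  have hr : (Vᴴ * V) * (X * z * Xᴴ)ᴴ = 1 := by
    have := congrArg conjTranspose hl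
    rwa [conjTranspose_mul, conjTranspose_one, conjTranspose_mul, conjTranspose_conjTranspose]
      at this
  have he : (X * z * Xᴴ)ᴴ = X * z * Xᴴ := by
    have h3 : (X * z * Xᴴ) * ((Vᴴ * V) * (X * z * Xᴴ)ᴴ) = X * z * Xᴴ := by
      rw [hr, Matrix.mul_one]
    rw [← Matrix.mul_assoc, hl, Matrix.one_mul] at h3
    exact h3
  rw [he] at hr
  exact ⟨⟨Vᴴ * V, X * z * Xᴴ, hr, hl⟩, rfl⟩

attribute [local instance] Matrix.linftyOpNormedRing Matrix.linftyOpNormedAlgebra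

theorem completeSpace_linftyOp : CompleteSpace (Matrix n n B) :=
  inferInstanceAs (CompleteSpace (n → n → B))

theorem continuousStar_linftyOp : ContinuousStar (Matrix n n B) :=
  inferInstance

/-- The `ℓ∞`-operator norm need not be a C⋆-norm, but completeness, continuity of the star and
invertibility of `1 + x⋆x` are enough. -/
theorem exists_matrix_inv_sqrt {w : Matrix n n B} (hw : wᴴ = w)
    (hpos : ∀ s : ℝ, 0 ≤ s → IsUnit (algebraMap ℝ (Matrix n n B) s + w)) :
    ∃ h : Matrix n n B, hᴴ = h ∧ h * h * w = 1 ∧ ∀ y, Commute y w → Commute y h :=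
  @exists_inv_sqrt (Matrix n n B) _ _ completeSpace_linftyOp _ continuousStar_linftyOp _
    (fun x => isUnit_one_add_conjTranspose_mul x) w hw hpos

/-- Polar decomposition of a left-invertible map out of a projection. -/
theorem exists_polar {V : Matrix m n (B)} {X : Matrix n m (B)}
    {P : Matrix n n (B)} (hP : IsStarProjection P) (hVP : V * P = V)
    (hXV : X * V = P) : ∃ h : Matrix n n (B),
      hᴴ = h ∧ h * h * (Vᴴ * V + (1 - P)) = 1 ∧ P * h = h * P ∧
      (V * h)ᴴ * (V * h) = P ∧ (V * h) * (V * h)ᴴ * V = V := by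
  have hPP := mul_self_of_isStarProjection hP
  have hPs := conjTranspose_of_isStarProjection hP
  have hPV : P * Vᴴ = Vᴴ := by
    have := congrArg conjTranspose hVP
    rwa [conjTranspose_mul, hPs] at this
  set w := Vᴴ * V + (1 - P) with hw
  have hws : wᴴ = w := by
    simp [hw, conjTranspose_add, conjTranspose_mul, conjTranspose_sub, hPs]
  have hwP : w * P = Vᴴ * V := by
    rw [hw, Matrix.add_mul, Matrix.mul_assoc, hVP, Matrix.sub_mul, Matrix.one_mul, hPP, sub_self,
      add_zero]
  have hPw : P * w = Vᴴ * V := by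
    rw [hw, Matrix.mul_add, ← Matrix.mul_assoc, hPV, Matrix.mul_sub, Matrix.mul_one, hPP, sub_self,
      add_zero]
  have hQ : (1 - P)ᴴ * (1 - P) = 1 - P := by
    rw [conjTranspose_sub, hPs, conjTranspose_one, Matrix.mul_sub, Matrix.mul_one, Matrix.sub_mul,
      Matrix.one_mul, hPP, sub_self, sub_zero]
  have hV' : (fromRows V (1 - P))ᴴ * fromRows V (1 - P) = w := by
    rw [conjTranspose_fromRows_eq_fromCols_conjTranspose, fromCols_mul_fromRows, hQ]
  have hpos : ∀ s : ℝ, 0 ≤ s → IsUnit (algebraMap ℝ (Matrix n n B) s + w) := by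
    intro s hs
    -- Here `w` is the Gram matrix of the rows `V` and `1 - P`. At `s = 0` invertibility comes from
    -- a left inverse of these rows, for `s > 0` from positivity.
    rcases hs.eq_or_lt with rfl | hs
    · rw [map_zero, zero_add, ← hV']
      refine isUnit_conjTranspose_mul_self (X := fromCols (P * X) (1 - P)) ?_
      rw [fromCols_mul_fromRows, Matrix.mul_assoc, hXV, hPP, Matrix.mul_sub, Matrix.mul_one,
        Matrix.sub_mul, Matrix.one_mul, hPP]
      abel
    · have h1 := isUnit_one_add_conjTranspose_mul ((Real.sqrt s)⁻¹ • fromRows V (1 - P))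
      rw [← isUnit_smul_iff_of_ne_zero hs.ne', conjTranspose_smul, star_trivial, Matrix.smul_mul,
        Matrix.mul_smul, smul_smul, ← mul_inv, Real.mul_self_sqrt hs.le, smul_add, smul_smul,
        mul_inv_cancel₀ hs.ne', one_smul, hV'] at h1
      rwa [Algebra.algebraMap_eq_smul_one]
  obtain ⟨h, h1, h2, h3⟩ := exists_matrix_inv_sqrt hws hpos
  have h4 : P * h = h * P := h3 P (hPw.trans hwP.symm)
  have h5 : w * h = h * w := h3 w (Commute.refl w)
  refine ⟨h, h1, h2, h4, ?_, ?_⟩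
  · rw [conjTranspose_mul, h1, Matrix.mul_assoc, ← Matrix.mul_assoc Vᴴ, ← hPw, Matrix.mul_assoc,
      h5, ← Matrix.mul_assoc, ← h4, Matrix.mul_assoc, ← Matrix.mul_assoc h, h2, Matrix.mul_one]
  · calc (V * h) * (V * h)ᴴ * V = V * (h * h * (Vᴴ * V)) := by
          simp only [conjTranspose_mul, h1, Matrix.mul_assoc]
      _ = V := by rw [← hwP, ← Matrix.mul_assoc (h * h), h2, Matrix.one_mul, hVP]

/-- The polar part of `Q x` is a partial isometry from `P` whose range projection `E` satisfies `Q E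
= E` and `E Q = Q`, hence equals `Q`. -/
theorem MatrixMvN.of_mul_eq {P : Matrix n n (B)} {Q : Matrix m m (B)}
    (hP : IsStarProjection P) (hQ : IsStarProjection Q) {x : Matrix m n (B)}
    {y : Matrix n m (B)} (hyx : y * x = P) (hxy : x * y = Q) : MatrixMvN P Q := by
  have hPP := mul_self_of_isStarProjection hP
  have hQQ := mul_self_of_isStarProjection hQ
  have hPs := conjTranspose_of_isStarProjection hP
  have hQs := conjTranspose_of_isStarProjection hQ
  have hxP : x * P = Q * x := by rw [← hyx, ← hxy, Matrix.mul_assoc]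
  have hVP : Q * x * P = Q * x := by rw [← hxP, Matrix.mul_assoc, hPP]
  have hXV : y * (Q * x) = P := by
    rw [← hxy, Matrix.mul_assoc, hyx, ← Matrix.mul_assoc, hyx, hPP]
  obtain ⟨h, h1, -, -, h4, h5⟩ := exists_polar hP hVP hXV
  refine ⟨Q * x * h, h4, ?_⟩
  set E := (Q * x * h) * (Q * x * h)ᴴ with hE
  have hEs : Eᴴ = E := by rw [hE, conjTranspose_mul, conjTranspose_conjTranspose]
  have hQE : Q * E = E := by
    simp only [hE, ← Matrix.mul_assoc, hQQ]
  have hEQ : E * Q = Q := by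
    have h6 : Q = (Q * x) * y := by rw [Matrix.mul_assoc, hxy, hQQ]
    nth_rewrite 1 [h6]
    rw [← Matrix.mul_assoc, h5, ← h6]
  rw [← hQE, ← hEs, ← hQs, ← conjTranspose_mul, hEQ]

end MatrixPositivity

open Matrix Algebra

/-! ### Elements as `1 × 1` matrices -/

section OneByOne

variable {R : Type*}

/-- An element of a ring as a `1 × 1` matrix. -/
def oneByOne (x : R) : Matrix (Fin 1) (Fin 1) R := Matrix.of fun _ _ => x

@[simp] theorem oneByOne_apply (x : R) (i j : Fin 1) : oneByOne x i j = x := rfl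

theorem oneByOne_mul [Ring R] (x y : R) : oneByOne (x * y) = oneByOne x * oneByOne y := by
  ext i j; simp [Matrix.mul_apply]

theorem oneByOne_add [Ring R] (x y : R) : oneByOne (x + y) = oneByOne x + oneByOne y := rfl

theorem oneByOne_zero [Ring R] : oneByOne (0 : R) = 0 := rfl

theorem oneByOne_star [Star R] (x : R) : oneByOne (star x) = (oneByOne x)ᴴ := rfl

theorem oneByOne_eta (M : Matrix (Fin 1) (Fin 1) R) : oneByOne (M 0 0) = M := by
  ext i j; rw [oneByOne_apply, Subsingleton.elim i 0, Subsingleton.elim j 0]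

theorem oneByOne_injective : Function.Injective (oneByOne : R → _) :=
  fun _ _ h => congrFun (congrFun h 0) 0

theorem isStarProjection_oneByOne [Ring R] [StarRing R] {p : R} (hp : IsStarProjection p) :
    IsStarProjection (oneByOne p) :=
  isStarProjection_of (by rw [← oneByOne_mul, hp.isIdempotentElem.eq])
    (by rw [← oneByOne_star, hp.isSelfAdjoint.star_eq])

theorem isStarProjection_of_oneByOne [Ring R] [StarRing R] {p : R} (hp : IsStarProjection (oneByOne p)) :
    IsStarProjection p := by
  refine ⟨oneByOne_injective ?_, oneByOne_injective ?_⟩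
  · rw [oneByOne_mul]; exact mul_self_of_isStarProjection hp
  · rw [oneByOne_star]; exact conjTranspose_of_isStarProjection hp

end OneByOne

/-! ### Factorization through a nonzero projection of the kernel -/

section Density

variable {B : Type*} [UnitalRealCStarAlgebra B]

/-- The kernel of `f` behaves like a simple purely infinite algebra: nonzero projections generate
dense ideals and are infinite. -/
structure IsPurelyInfiniteSimpleKer (f : B →⋆ₙ+* ℝ) : Prop where
  dense : ∀ r : B, IsStarProjection r → r ≠ 0 → f r = 0 → ∀ x, f x = 0 →
    x ∈ closure (AddSubmonoid.closure {y : B | ∃ a b, f a = 0 ∧ f b = 0 ∧ y = a * r * b} : Set B)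
  infinite : ∀ q : B, IsStarProjection q → q ≠ 0 → f q = 0 →
    ∃ v : B, f v = 0 ∧ star v * v = q ∧ q * v = v ∧ v * star v ≠ q

theorem mul_eq_self_of_star_mul_self_eq {A : Type*} [NonUnitalNormedRing A] [StarRing A] [CStarRing A]
    {v q : A} (hq : IsStarProjection q)
    (hv : star v * v = q) : v * q = v := by
  have hqq : q * q = q := hq.isIdempotentElem.eq
  have hqs : star q = q := hq.isSelfAdjoint.star_eq
  rw [← sub_eq_zero, ← CStarRing.star_mul_self_eq_zero_iff]
  have h1 : star v * (v * q) = q := by rw [← mul_assoc, hv, hqq]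
  rw [star_sub, star_mul, hqs, sub_mul, mul_sub, mul_sub, mul_assoc q, mul_assoc q, h1, hv, hqq]
  abel

/-- The elements `vⁱ r` are partial isometries with orthogonal ranges, so `∑ aᵢ r bᵢ` equals the
single product `(∑ aᵢ r v⋆ⁱ)(∑ vⁱ r bᵢ)`. The condition `v⋆ⁿ b = 0` leaves the range of `vⁿ` free.
-/
theorem exists_mul_of_mem_closure {q v r : B} (hq : IsStarProjection q) (hv : star v * v = q)
    (hqv : q * v = v) (hr : r = q - v * star v) {S : Set B}
    (hS : ∀ y ∈ S, ∃ a b, y = a * r * b) {x : B} (hx : x ∈ AddSubmonoid.closure S) :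
    ∃ (n : ℕ) (a b : B), x = a * b ∧ q * b = b ∧ star v ^ n * b = 0 := by
  have hqq : q * q = q := hq.isIdempotentElem.eq
  have hvq := mul_eq_self_of_star_mul_self_eq hq hv
  have hvr : star v * r = 0 := by
    rw [hr, mul_sub, ← mul_assoc, hv]
    have := congrArg star hvq
    have h2 := congrArg star hqv
    rw [star_mul, hq.isSelfAdjoint.star_eq] at this h2
    rw [h2, this, sub_self]
  have hqr : q * r = r := by rw [hr, mul_sub, hqq, ← mul_assoc, hqv]
  have hrr : r * r = r := by
    nth_rewrite 1 [hr]
    rw [sub_mul, hqr, mul_assoc, hvr, mul_zero, sub_zero]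
  have hpow : ∀ n : ℕ, q * v ^ n * r = v ^ n * r := by
    intro n
    cases n with
    | zero => simp [hqr]
    | succ n => rw [pow_succ', ← mul_assoc, hqv]
  have hvv : ∀ n : ℕ, star v ^ n * (v ^ n * r) = r := by
    intro n
    induction n with
    | zero => simp
    | succ n ih =>
      calc star v ^ (n + 1) * (v ^ (n + 1) * r)
          = star v ^ n * ((star v * v) * v ^ n * r) := by
            rw [pow_succ (star v), pow_succ' v]; simp only [mul_assoc]
        _ = r := by rw [hv, hpow, ih]
  induction hx using AddSubmonoid.closure_induction_left with
  | zero => exact ⟨0, 0, 0, by simp, by simp, by simp⟩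
  | add_left y hy x _ ih =>
    obtain ⟨n, a, b, rfl, hb, hvb⟩ := ih
    obtain ⟨a', b', rfl⟩ := hS y hy
    -- The factor `1 - vⁿ v⋆ⁿ` fixes the old `b` and kills the new summand `vⁿ r b'`, so no cross
    -- terms survive.
    refine ⟨n + 1, a * (1 - v ^ n * star v ^ n) + a' * r * star v ^ n, b + v ^ n * r * b', ?_, ?_,
      ?_⟩
    · have h1 : star v ^ n * (b + v ^ n * r * b') = r * b' := by
        rw [mul_add, hvb, zero_add, ← mul_assoc (star v ^ n), hvv]
      rw [add_mul, mul_assoc a, sub_mul, one_mul, mul_assoc (v ^ n) (star v ^ n), h1,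
        mul_assoc (a' * r), h1, mul_assoc (v ^ n) r, add_sub_cancel_right, mul_assoc a' r (r * b'),
        ← mul_assoc r r, hrr, mul_assoc a' r b', add_comm]
    · rw [mul_add, hb, ← mul_assoc, ← mul_assoc, hpow]
    · rw [pow_succ', mul_assoc, mul_add, hvb, zero_add, ← mul_assoc (star v ^ n), hvv, ← mul_assoc,
        hvr, zero_mul]

theorem isOpen_isUnit {M : Type*} [NormedRing M] [CompleteSpace M] : IsOpen {x : M | IsUnit x} :=
  Units.isOpen

theorem isOpen_isUnit_matrix {n : Type*} [Fintype n] [DecidableEq n] :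
    IsOpen {x : Matrix n n B | IsUnit x} :=
  @isOpen_isUnit (Matrix n n B) Matrix.linftyOpNormedRing completeSpace_linftyOp

/-- Approximate `q` by one product `a b` with `v⋆ⁿ b = 0`. The polar part `s` of `b q` then has
range orthogonal to that of `t = vⁿ q`. -/
theorem exists_orthogonal_isometries {f : B →⋆ₙ+* ℝ} (hf : IsPurelyInfiniteSimpleKer f) {q : B}
    (hq : IsStarProjection q) (hq0 : q ≠ 0) (hfq : f q = 0) :
    ∃ s t : B, star s * s = q ∧ star t * t = q ∧ star s * t = 0 ∧ q * s = s ∧ q * t = t := by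
  have hqq : q * q = q := hq.isIdempotentElem.eq
  have hqs : star q = q := hq.isSelfAdjoint.star_eq
  obtain ⟨v, hfv, hv, hqv, hne⟩ := hf.infinite q hq hq0 hfq
  have hvq := mul_eq_self_of_star_mul_self_eq hq hv
  have hvs : star v * q = star v := by
    have := congrArg star hqv
    rwa [star_mul, hqs] at this
  set r := q - v * star v with hr
  have hr0 : r ≠ 0 := fun h => hne (sub_eq_zero.1 h).symm
  have hrp : IsStarProjection r := by
    refine ⟨?_, ?_⟩
    · show r * r = r
      rw [hr, mul_sub, sub_mul, sub_mul, hqq, mul_assoc v, hvs, ← mul_assoc q, hqv, mul_assoc v,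
        ← mul_assoc (star v), hv, ← mul_assoc, hvq, sub_self, sub_zero]
    · show star r = r
      rw [hr, star_sub, hqs, star_mul, star_star]
  have hfr : f r = 0 := by rw [hr, map_sub, map_mul, hfq, hfv, zero_mul, sub_zero]
  have hcl := hf.dense r hrp hr0 hfr q hfq
  have hopen : IsOpen {x : B | IsUnit (1 - (q - q * x * q))} :=
    Units.isOpen.preimage (by fun_prop : Continuous fun x : B => 1 - (q - q * x * q))
  obtain ⟨x, hx, hxS⟩ := mem_closure_iff.1 hcl _ hopen (by simp [hqq])
  obtain ⟨n, a, b, rfl, hqb, hvb⟩ := exists_mul_of_mem_closure hq hv hqv hr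
    (by rintro _ ⟨a, b, -, -, h⟩; exact ⟨a, b, h⟩) hxS
  obtain ⟨z, hz⟩ := hx
  have hzq : (z : B) * q = q * a * (b * q) := by
    rw [hz, sub_mul, one_mul, sub_mul, hqq, mul_assoc (q * (a * b)), hqq, sub_sub_cancel]
    simp only [mul_assoc]
  have hXV : (↑z⁻¹ * (q * a)) * (b * q) = q := by
    rw [mul_assoc, ← hzq, ← mul_assoc, Units.inv_mul, one_mul]
  obtain ⟨h, -, -, -, h4, -⟩ := exists_polar (V := oneByOne (b * q))
    (X := oneByOne (↑z⁻¹ * (q * a))) (isStarProjection_oneByOne hq)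
    (by rw [← oneByOne_mul, mul_assoc, hqq]) (by rw [← oneByOne_mul, hXV])
  rw [← oneByOne_eta h, ← oneByOne_mul, ← oneByOne_star, ← oneByOne_mul] at h4
  have h5 := oneByOne_injective h4
  set s := b * q * h 0 0 with hs
  have hvn : ∀ n : ℕ, star v ^ n * (v ^ n * q) = q ∧ q * v ^ n * q = v ^ n * q := by
    intro n
    induction n with
    | zero => simp [hqq]
    | succ n ih =>
      refine ⟨?_, by rw [pow_succ', ← mul_assoc, hqv]⟩
      calc star v ^ (n + 1) * (v ^ (n + 1) * q)
          = star v ^ n * ((star v * v) * v ^ n * q) := by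
            rw [pow_succ (star v), pow_succ' v]; simp only [mul_assoc]
        _ = q := by rw [hv, ih.2, ih.1]
  refine ⟨s, v ^ n * q, h5, ?_, ?_, ?_, ?_⟩
  · rw [star_mul, star_pow, hqs, mul_assoc, (hvn n).1, hqq]
  · rw [← star_eq_zero, star_mul, star_star, star_mul, star_pow, hqs, hs, mul_assoc q]
    simp only [← mul_assoc]
    rw [mul_assoc q, hvb]
    simp
  · rw [hs, ← mul_assoc, ← mul_assoc, hqb]
  · rw [← mul_assoc, (hvn n).2]

variable {m n : Type*}

/-- The matrices `b c` with `b` a column in `B q` and `c` a row in `q B`. -/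
def columnRow (q : B) (m n : Type*) : Set (Matrix m n B) :=
  {T | ∃ (b : Matrix m (Fin 1) B) (c : Matrix (Fin 1) n B),
    b * oneByOne q = b ∧ oneByOne q * c = c ∧ T = b * c}

/-- The isometries make the set of products additive: `b c + b' c' = (b s⋆ + b' t⋆)(s c + t c')`. It
then suffices to approximate matrices with one nonzero entry, where density of the ideal generated
by `q` applies. -/
theorem mem_closure_columnRow [Fintype m] [Fintype n] [DecidableEq m] [DecidableEq n]
    {f : B →⋆ₙ+* ℝ} (hf : IsPurelyInfiniteSimpleKer f) {q : B}
    (hq : IsStarProjection q) (hq0 : q ≠ 0) (hfq : f q = 0) {T : Matrix m n B}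
    (hT : ∀ i j, f (T i j) = 0) : T ∈ closure (columnRow q m n) := by
  have hqq : q * q = q := hq.isIdempotentElem.eq
  have hqs : star q = q := hq.isSelfAdjoint.star_eq
  obtain ⟨s, t, hs, ht, hst, hqs', hqt⟩ := exists_orthogonal_isometries hf hq hq0 hfq
  have hts : star t * s = 0 := by
    rw [← star_eq_zero, star_mul, star_star, hst]
  have hss : star s * q = star s := by
    have := congrArg star hqs'
    rwa [star_mul, hqs] at this
  have htt : star t * q = star t := by
    have := congrArg star hqt
    rwa [star_mul, hqs] at this
  let D : AddSubmonoid (Matrix m n B) :=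
    { carrier := columnRow q m n
      zero_mem' := ⟨0, 0, by simp, by simp, by simp⟩
      add_mem' := by
        rintro _ _ ⟨b, c, hb, hc, rfl⟩ ⟨b', c', hb', hc', rfl⟩
        refine ⟨b * oneByOne (star s) + b' * oneByOne (star t), oneByOne s * c + oneByOne t * c',
          ?_, ?_, ?_⟩
        · rw [Matrix.add_mul, Matrix.mul_assoc, Matrix.mul_assoc, ← oneByOne_mul, ← oneByOne_mul,
            hss, htt]
        · rw [Matrix.mul_add, ← Matrix.mul_assoc, ← Matrix.mul_assoc, ← oneByOne_mul,
            ← oneByOne_mul, hqs', hqt]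
        · have h (x y : B) (β : Matrix m (Fin 1) B) (γ : Matrix (Fin 1) n B) :
              β * oneByOne x * (oneByOne y * γ) = β * oneByOne (x * y) * γ := by
            rw [oneByOne_mul]; simp only [Matrix.mul_assoc]
          rw [Matrix.add_mul, Matrix.mul_add, Matrix.mul_add, h, h, h, h, hs, ht, hst, hts, hb,
            hb', oneByOne_zero]
          simp }
  have hsingle : ∀ i j (x : B), f x = 0 → Matrix.single i j x ∈ D.topologicalClosure := by
    intro i j x hx
    refine map_mem_closure (f := fun x : B => Matrix.single i j x)
      (continuous_matrix fun k l => by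
        simp only [Matrix.single_apply]; split_ifs <;> fun_prop)
      (hf.dense q hq hq0 hfq x hx) ?_
    suffices h : AddSubmonoid.closure {y : B | ∃ a b, f a = 0 ∧ f b = 0 ∧ y = a * q * b}
        ≤ D.comap (Matrix.singleAddMonoidHom i j) from h
    rw [AddSubmonoid.closure_le]
    rintro _ ⟨a, b, -, -, rfl⟩
    refine ⟨Matrix.single i 0 (a * q), Matrix.single 0 j (q * b), ?_, ?_, ?_⟩
    · ext k l
      simp [Matrix.mul_apply, Matrix.single_apply, Subsingleton.elim l 0, ite_mul, mul_assoc, hqq]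
    · ext k l
      simp [Matrix.mul_apply, Matrix.single_apply, Subsingleton.elim k 0, mul_ite, ← mul_assoc, hqq]
    · show Matrix.single i j (a * q * b) = _
      rw [Matrix.single_mul_single_same, ← mul_assoc, mul_assoc a q q, hqq]
  rw [Matrix.matrix_eq_sum_single T]
  show _ ∈ D.topologicalClosure
  exact sum_mem fun i _ => sum_mem fun j _ => hsingle i j _ (hT i j)

theorem exists_columnRow_isUnit {k : Type*} [Fintype k] [DecidableEq k] [Fintype m] [Fintype n]
    [DecidableEq m] [DecidableEq n]
    {f : B →⋆ₙ+* ℝ} (hf : IsPurelyInfiniteSimpleKer f) {q : B}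
    (hq : IsStarProjection q) (hq0 : q ≠ 0) (hfq : f q = 0) {T : Matrix m n B}
    (hT : ∀ i j, f (T i j) = 0) {φ : Matrix m n B → Matrix k k B} (hφ : Continuous φ)
    (hφT : φ T = 1) : ∃ (b : Matrix m (Fin 1) B) (c : Matrix (Fin 1) n B),
      b * oneByOne q = b ∧ oneByOne q * c = c ∧ IsUnit (φ (b * c)) := by
  obtain ⟨_, hx, b, c, hb, hc, rfl⟩ := mem_closure_iff.1 (mem_closure_columnRow hf hq hq0 hfq hT) _
    (isOpen_isUnit_matrix.preimage hφ) (by simp [hφT])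
  exact ⟨b, c, hb, hc, hx⟩

/-- Every matrix projection over the kernel is equivalent to a proper subprojection of any given
nonzero projection of the kernel. -/
theorem exists_subprojection [Fintype n] [DecidableEq n]
    {f : B →⋆ₙ+* ℝ} (hf : IsPurelyInfiniteSimpleKer f) {q : B}
    (hq : IsStarProjection q) (hq0 : q ≠ 0) (hfq : f q = 0) {r : Matrix n n B}
    (hr : IsStarProjection r) (hfr : ∀ i j, f (r i j) = 0) :
    ∃ e : B, IsStarProjection e ∧ q * e = e ∧ e ≠ q ∧ MatrixMvN r (oneByOne e) := by
  have hqq : q * q = q := hq.isIdempotentElem.eq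
  have hrr := mul_self_of_isStarProjection hr
  obtain ⟨s, t, hs, ht, hst, hqs', hqt⟩ := exists_orthogonal_isometries hf hq hq0 hfq
  obtain ⟨b, c, hb, hc, hu⟩ := exists_columnRow_isUnit hf hq hq0 hfq hfr
    (φ := fun T => 1 - (r - r * T * r)) (by fun_prop) (by simp [hrr])
  obtain ⟨z, hz⟩ := hu
  have hzr : (z : Matrix n n B) * r = r * b * (c * r) := by
    rw [hz, Matrix.sub_mul, Matrix.one_mul, Matrix.sub_mul, hrr, Matrix.mul_assoc _ r r, hrr,
      sub_sub_cancel]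
    simp only [Matrix.mul_assoc]
  obtain ⟨h, -, -, h3, h4, -⟩ := exists_polar (V := c * r)
    (X := (↑z⁻¹ : Matrix n n B) * (r * b)) hr (by rw [Matrix.mul_assoc, hrr])
    (by rw [Matrix.mul_assoc, ← hzr, ← Matrix.mul_assoc, Units.inv_mul, Matrix.one_mul])
  set U := c * r * h with hU
  have hqU : oneByOne q * U = U := by rw [hU, ← Matrix.mul_assoc, ← Matrix.mul_assoc, hc]
  -- Composing with `s` keeps the range orthogonal to that of `t`, which makes the subprojection
  -- proper.
  set W := oneByOne s * U with hW
  have hWW : Wᴴ * W = r := by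
    rw [hW, conjTranspose_mul, ← oneByOne_star, Matrix.mul_assoc, ← Matrix.mul_assoc (oneByOne _),
      ← oneByOne_mul, hs, hqU, h4]
  have heta := oneByOne_eta (W * Wᴴ)
  have hWr : W * r = W := by
    rw [hW, hU, Matrix.mul_assoc, Matrix.mul_assoc _ h r, ← h3, ← Matrix.mul_assoc (c * r),
      Matrix.mul_assoc c r r, hrr]
  have hproj : IsStarProjection (W * Wᴴ) := by
    refine isStarProjection_of ?_ (by rw [conjTranspose_mul, conjTranspose_conjTranspose])
    rw [← Matrix.mul_assoc, Matrix.mul_assoc W, hWW, hWr]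
  refine ⟨(W * Wᴴ) 0 0, ?_, ?_, ?_, W, hWW, heta.symm⟩
  · apply isStarProjection_of_oneByOne
    rwa [heta]
  · apply oneByOne_injective
    rw [oneByOne_mul, heta, ← Matrix.mul_assoc, hW, ← Matrix.mul_assoc, ← oneByOne_mul, hqs']
  · intro he
    have h6 : oneByOne ((W * Wᴴ) 0 0) * oneByOne t = 0 := by
      rw [heta, hW, conjTranspose_mul, ← oneByOne_star, Matrix.mul_assoc (oneByOne s * U),
        Matrix.mul_assoc Uᴴ, ← oneByOne_mul, hst, oneByOne_zero, Matrix.mul_zero, Matrix.mul_zero]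
    rw [he, ← oneByOne_mul, hqt] at h6
    have h7 : t = 0 := oneByOne_injective (h6.trans oneByOne_zero.symm)
    rw [h7, mul_zero] at ht
    exact hq0 ht.symm

end Density

/-! ### Calculus of projection classes and the Grothendieck group -/

section ProjectionClasses

variable {R S : Type*} [Ring R] [StarRing R] [Ring S] [StarRing S]
variable {ι κ : Type*} [Fintype ι] [Fintype κ]

/-- The class in `V(R)` of a matrix projection indexed by an arbitrary finite type. -/
noncomputable def projClass (P : Matrix ι ι R) (hP : IsStarProjection P) : ProjectionMonoid R :=
  ProjectionMonoid.mk ⟨Fintype.card ι,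
    P.submatrix (Fintype.equivFin ι).symm (Fintype.equivFin ι).symm,
    isStarProjection_submatrix hP _⟩

theorem ProjectionMonoid.mk_eq_mk_iff {P Q : MatrixProjection R} :
    ProjectionMonoid.mk P = ProjectionMonoid.mk Q ↔ MatrixMvN P.2.1 Q.2.1 :=
  ⟨fun h => Quotient.exact h, ProjectionMonoid.mk_eq⟩

theorem mk_eq_projClass (P : MatrixProjection R) :
    ProjectionMonoid.mk P = projClass P.2.1 P.2.2 :=
  ProjectionMonoid.mk_eq (MatrixMvN.submatrix P.2.2 _).symm

theorem projClass_eq_iff {P : Matrix ι ι R} {Q : Matrix κ κ R} (hP : IsStarProjection P)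
    (hQ : IsStarProjection Q) : projClass P hP = projClass Q hQ ↔ MatrixMvN P Q := by
  rw [projClass, projClass, ProjectionMonoid.mk_eq_mk_iff]
  have h1 := MatrixMvN.submatrix hP (Fintype.equivFin ι).symm
  have h2 := MatrixMvN.submatrix hQ (Fintype.equivFin κ).symm
  exact ⟨fun h => (h1.symm.trans hP (isStarProjection_submatrix hQ _) h).trans hP hQ h2,
    fun h => (h1.trans (isStarProjection_submatrix hP _) hQ h).trans
      (isStarProjection_submatrix hP _) (isStarProjection_submatrix hQ _) h2.symm⟩

theorem projClass_fromBlocks {P : Matrix ι ι R} {Q : Matrix κ κ R} (hP : IsStarProjection P)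
    (hQ : IsStarProjection Q) :
    projClass (fromBlocks P 0 0 Q) (isStarProjection_fromBlocks hP hQ)
      = projClass P hP + projClass Q hQ := by
  rw [projClass, projClass, projClass, ProjectionMonoid.mk_add_mk, ProjectionMonoid.mk_eq_mk_iff]
  have h1 := MatrixMvN.submatrix (isStarProjection_fromBlocks hP hQ)
    (Fintype.equivFin (ι ⊕ κ)).symm
  have h2 := MatrixProjection.sum_mvn
    ⟨_, _, isStarProjection_submatrix hP (Fintype.equivFin ι).symm⟩
    ⟨_, _, isStarProjection_submatrix hQ (Fintype.equivFin κ).symm⟩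
  have h3 := MatrixMvN.fromBlocks (MatrixMvN.submatrix hP (Fintype.equivFin ι).symm)
    (MatrixMvN.submatrix hQ (Fintype.equivFin κ).symm)
  exact h1.trans (isStarProjection_submatrix (isStarProjection_fromBlocks hP hQ) _)
    (MatrixProjection.sum _ _).2.2
    (h3.symm.trans (isStarProjection_fromBlocks hP hQ) (MatrixProjection.sum _ _).2.2 h2.symm)

theorem isStarProjection_add {P Q : Matrix ι ι R} (hP : IsStarProjection P)
    (hQ : IsStarProjection Q) (hPQ : P * Q = 0) : IsStarProjection (P + Q) := by
  have hQP : Q * P = 0 := by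
    have := congrArg conjTranspose hPQ
    rwa [conjTranspose_mul, conjTranspose_of_isStarProjection hP,
      conjTranspose_of_isStarProjection hQ, conjTranspose_zero] at this
  refine isStarProjection_of ?_ ?_
  · rw [Matrix.add_mul, Matrix.mul_add, Matrix.mul_add, hPQ, hQP, mul_self_of_isStarProjection hP,
      mul_self_of_isStarProjection hQ, add_zero, zero_add]
  · rw [conjTranspose_add, conjTranspose_of_isStarProjection hP,
      conjTranspose_of_isStarProjection hQ]

theorem projClass_add {P Q : Matrix ι ι R} (hP : IsStarProjection P) (hQ : IsStarProjection Q)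
    (hPQ : P * Q = 0) :
    projClass (P + Q) (isStarProjection_add hP hQ hPQ) = projClass P hP + projClass Q hQ := by
  have hPs := conjTranspose_of_isStarProjection hP
  have hQs := conjTranspose_of_isStarProjection hQ
  have hQP : Q * P = 0 := by
    have := congrArg conjTranspose hPQ
    rwa [conjTranspose_mul, hPs, hQs, conjTranspose_zero] at this
  rw [← projClass_fromBlocks, projClass_eq_iff]
  refine ⟨fromRows P Q, ?_, ?_⟩
  · rw [conjTranspose_fromRows_eq_fromCols_conjTranspose, fromCols_mul_fromRows, hPs, hQs,
      mul_self_of_isStarProjection hP, mul_self_of_isStarProjection hQ]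
  · rw [conjTranspose_fromRows_eq_fromCols_conjTranspose, fromRows_mul_fromCols, hPs, hQs,
      mul_self_of_isStarProjection hP, mul_self_of_isStarProjection hQ, hPQ, hQP]

theorem isStarProjection_sub {P Q : Matrix ι ι R} (hP : IsStarProjection P)
    (hQ : IsStarProjection Q) (hPQ : Q * P = P) : IsStarProjection (Q - P) := by
  have hPs := conjTranspose_of_isStarProjection hP
  have hQs := conjTranspose_of_isStarProjection hQ
  have hQP : P * Q = P := by
    have := congrArg conjTranspose hPQ
    rwa [conjTranspose_mul, hPs, hQs] at this
  refine isStarProjection_of ?_ (by rw [conjTranspose_sub, hPs, hQs])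
  rw [Matrix.sub_mul, Matrix.mul_sub, Matrix.mul_sub, hPQ, hQP, mul_self_of_isStarProjection hP,
    mul_self_of_isStarProjection hQ, sub_self, sub_zero]

theorem projClass_add_sub {P Q : Matrix ι ι R} (hP : IsStarProjection P)
    (hQ : IsStarProjection Q) (hPQ : Q * P = P) :
    projClass P hP + projClass (Q - P) (isStarProjection_sub hP hQ hPQ) = projClass Q hQ := by
  have hPs := conjTranspose_of_isStarProjection hP
  have hQs := conjTranspose_of_isStarProjection hQ
  have hQP : P * Q = P := by
    have := congrArg conjTranspose hPQ
    rwa [conjTranspose_mul, hPs, hQs] at this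
  rw [← projClass_add hP (isStarProjection_sub hP hQ hPQ)
    (by rw [Matrix.mul_sub, hQP, mul_self_of_isStarProjection hP, sub_self])]
  congr 1
  rw [add_sub_cancel]

variable (R) in
/-- The class of the identity matrix. -/
noncomputable def oneClass (ι : Type*) [Fintype ι] [DecidableEq ι] : ProjectionMonoid R :=
  projClass (1 : Matrix ι ι R) (.one _)

theorem oneClass_add [DecidableEq ι] [DecidableEq κ] :
    oneClass R ι + oneClass R κ = oneClass R (ι ⊕ κ) := by
  rw [oneClass, oneClass, ← projClass_fromBlocks, oneClass]
  congr 1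
  exact fromBlocks_one

theorem exists_add_eq_oneClass (x : ProjectionMonoid R) :
    ∃ (y : ProjectionMonoid R) (n : ℕ), x + y = oneClass R (Fin n) := by
  induction x using Quotient.inductionOn with | _ p
  obtain ⟨n, p, hp⟩ := p
  refine ⟨projClass (1 - p) (isStarProjection_sub hp (.one _) (Matrix.one_mul p)), n, ?_⟩
  rw [oneClass, ← projClass_add_sub hp (.one _) (Matrix.one_mul p)]
  congr 1
  exact mk_eq_projClass _

theorem projectionMonoid_map_projClass (f : R →⋆ₙ+* S) {P : Matrix ι ι R}
    (hP : IsStarProjection P) : ProjectionMonoid.map f (projClass P hP)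
      = projClass (P.map f) (ProjectionMonoid.isStarProjection_map f hP) := rfl

theorem of_eq_of_iff {W : Type*} [AddCommMonoid W] {x y : W} :
    GrothendieckAddGroup.of x = GrothendieckAddGroup.of y ↔ ∃ c, c + x = c + y := by
  refine ((AddLocalization.addMonoidOf (⊤ : AddSubmonoid W)).eq_iff_exists).trans
    ⟨fun ⟨c, h⟩ => ⟨c, h⟩, fun ⟨c, h⟩ => ⟨⟨c, trivial⟩, h⟩⟩

theorem exists_of_sub_of {W : Type*} [AddCommMonoid W] (α : GrothendieckAddGroup W) :
    ∃ x y : W, α = GrothendieckAddGroup.of x - GrothendieckAddGroup.of y := by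
  obtain ⟨⟨x, y⟩, h⟩ := (AddLocalization.addMonoidOf (⊤ : AddSubmonoid W)).surj α
  exact ⟨x, y, eq_sub_of_add_eq h⟩

theorem K0.map_of (f : R →⋆ₙ+* S) (x : ProjectionMonoid R) :
    K0.map f (GrothendieckAddGroup.of x)
      = GrothendieckAddGroup.of (ProjectionMonoid.map f x) := by
  have h := GrothendieckAddGroup.lift.symm_apply_apply
    (GrothendieckAddGroup.of.comp (ProjectionMonoid.map f))
  rw [GrothendieckAddGroup.lift_symm_apply] at h
  exact DFunLike.congr_fun h x

end ProjectionClasses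

/-! ### Solvable equations force a group -/

section Cancellation

theorem exists_zero_and_cancel_of_solvable {W : Type*} [AddCommMonoid W] {S : Set W}
    (hS : S.Nonempty) (hsolve : ∀ a ∈ S, ∀ b ∈ S, ∃ x ∈ S, a + x = b) :
    ∃ e ∈ S, (∀ a ∈ S, a + e = a) ∧ ∀ a ∈ S, ∀ b ∈ S, ∀ c ∈ S, a + c = b + c → a = b := by
  obtain ⟨a₀, ha₀⟩ := hS
  obtain ⟨e, he, hae⟩ := hsolve a₀ ha₀ a₀ ha₀
  have hneutral : ∀ a ∈ S, a + e = a := by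
    intro a ha
    obtain ⟨x, -, rfl⟩ := hsolve a₀ ha₀ a ha
    rw [add_right_comm, hae]
  refine ⟨e, he, hneutral, fun a ha b hb c hc h => ?_⟩
  obtain ⟨d, -, hcd⟩ := hsolve c hc e he
  rw [← hneutral a ha, ← hneutral b hb, ← hcd, ← add_assoc, h, add_assoc]

end Cancellation

/-! ### Classes of nonzero projections in the kernel -/

section Kernel

variable {B : Type*} [UnitalRealCStarAlgebra B]

/-- The classes in `V(B)` of the nonzero projections in the kernel of `f`. -/
def kerClasses (f : B →⋆ₙ+* ℝ) : Set (ProjectionMonoid B) :=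
  {w | ∃ (p : B) (hp : IsStarProjection p), p ≠ 0 ∧ f p = 0 ∧
    w = projClass (oneByOne p) (isStarProjection_oneByOne hp)}

theorem map_eq_zero_of_mul_eq {f : B →⋆ₙ+* ℝ} {q e : B} (hfq : f q = 0) (h : q * e = e) :
    f e = 0 := by rw [← h, map_mul, hfq, zero_mul]

/-- Embed `r` as a proper subprojection `e` of `q`; the solution is the class of `q - e`, nonzero
because `e` is proper. -/
theorem exists_projClass_add_eq {ι : Type*} [Fintype ι] [DecidableEq ι] {f : B →⋆ₙ+* ℝ}
    (hf : IsPurelyInfiniteSimpleKer f) {r : Matrix ι ι B} (hr : IsStarProjection r)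
    (hfr : ∀ i j, f (r i j) = 0) {b : ProjectionMonoid B} (hb : b ∈ kerClasses f) :
    ∃ x ∈ kerClasses f, projClass r hr + x = b := by
  obtain ⟨q, hq, hq0, hfq, rfl⟩ := hb
  obtain ⟨e, he, hqe, hne, hre⟩ := exists_subprojection hf hq hq0 hfq hr hfr
  have hqe' : oneByOne q * oneByOne e = oneByOne e := by rw [← oneByOne_mul, hqe]
  have hpr := isStarProjection_sub (isStarProjection_oneByOne he) (isStarProjection_oneByOne hq)
    hqe'
  refine ⟨_, ⟨q - e, isStarProjection_of_oneByOne hpr, sub_ne_zero.2 hne.symm, ?_, rfl⟩, ?_⟩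
  · rw [map_sub, hfq, map_eq_zero_of_mul_eq hfq hqe, sub_zero]
  · rw [(projClass_eq_iff hr (isStarProjection_oneByOne he)).2 hre]
    exact projClass_add_sub _ _ hqe'

theorem exists_add_eq_of_mem_kerClasses {f : B →⋆ₙ+* ℝ} (hf : IsPurelyInfiniteSimpleKer f)
    {a b : ProjectionMonoid B} (ha : a ∈ kerClasses f) (hb : b ∈ kerClasses f) :
    ∃ x ∈ kerClasses f, a + x = b := by
  obtain ⟨p, hp, -, hfp, rfl⟩ := ha
  exact exists_projClass_add_eq hf (isStarProjection_oneByOne hp) (fun _ _ => hfp) hb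

end Kernel

/-! ### Comparison with `K₀`: absorption of defects and stable embedding -/

section Kernel

theorem map_conjTranspose_of_star {B ι κ : Type*} [UnitalRealCStarAlgebra B] (f : B →⋆ₙ+* ℝ)
    (M : Matrix ι κ B) : Mᴴ.map f = (M.map f)ᴴ :=
  conjTranspose_map _ (map_star f)

variable {B : Type*} [UnitalRealCStarAlgebra B] {ι κ : Type*} [Fintype ι] [Fintype κ]
  [DecidableEq ι] [DecidableEq κ]

/-- A matrix isometry with range projection `1 - P`, where `P` has entries in the kernel of `f`, can
be taken to be the identity modulo the kernel. -/
theorem exists_isometry_map_eq_one {f : B →⋆ₙ+* ℝ} (hfa : ∀ s : ℝ, f (algebraMap ℝ B s) = s)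
    {V : Matrix ι ι B} (hV : Vᴴ * V = 1) (hfV : (V * Vᴴ).map f = 1) :
    ∃ W : Matrix ι ι B, Wᴴ * W = 1 ∧ W * Wᴴ = V * Vᴴ ∧ W.map f = 1 := by
  set v := V.map f with hv
  have hvv : v * vᴴ = 1 := by
    rw [hv, ← map_conjTranspose_of_star, ← Matrix.map_mul, hfV]
  have hvv' : vᴴ * v = 1 := mul_eq_one_comm.1 hvv
  -- Correct `V` by the scalar orthogonal matrix inverse to its image under `f`; this does not
  -- change `V V⋆`.
  set O : Matrix ι ι B := vᴴ.map (algebraMap ℝ B) with hO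
  have hOs : Oᴴ = v.map (algebraMap ℝ B) := by
    rw [hO, ← conjTranspose_map _ (fun s => (star_algebraMap_real s).symm), conjTranspose_conjTranspose]
  have hOO : Oᴴ * O = 1 := by
    rw [hOs, hO, ← Matrix.map_mul, hvv, Matrix.map_one _ (map_zero _) (map_one _)]
  have hOO' : O * Oᴴ = 1 := by
    rw [hOs, hO, ← Matrix.map_mul, hvv', Matrix.map_one _ (map_zero _) (map_one _)]
  refine ⟨V * O, ?_, ?_, ?_⟩
  · rw [conjTranspose_mul, Matrix.mul_assoc, ← Matrix.mul_assoc Vᴴ, hV, Matrix.one_mul, hOO]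
  · rw [conjTranspose_mul, Matrix.mul_assoc, ← Matrix.mul_assoc O, hOO', Matrix.one_mul]
  · have : O.map f = vᴴ := by
      ext i j
      simp [hO, hfa]
    rw [Matrix.map_mul, this, ← hv, hvv]

/-- If `V` is an isometry which is the identity modulo the kernel, then the class of `1 - V V⋆` is
absorbed by the class of a nonzero projection. -/
theorem exists_add_eq_self_of_isometry {f : B →⋆ₙ+* ℝ} (hf : IsPurelyInfiniteSimpleKer f)
    {q : B} (hq : IsStarProjection q) (hq0 : q ≠ 0) (hfq : f q = 0)
    {V : Matrix ι ι B} (hV : Vᴴ * V = 1) (hfV : V.map f = 1)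
    (hp : IsStarProjection (1 - V * Vᴴ)) :
    projClass (1 - V * Vᴴ) hp + projClass (oneByOne q) (isStarProjection_oneByOne hq)
      = projClass (oneByOne q) (isStarProjection_oneByOne hq) := by
  set Q := oneByOne q
  have hQ : IsStarProjection Q := isStarProjection_oneByOne hq
  have hQQ := mul_self_of_isStarProjection hQ
  have hQs := conjTranspose_of_isStarProjection hQ
  have hfa : ∀ i j, f ((V - 1) i j) = 0 := by
    intro i j
    have h1 := congrFun (congrFun hfV i) j
    rw [Matrix.map_apply] at h1
    have hf1 : f 1 = 1 := by
      have h2 := congrFun (congrFun hfV i) i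
      rw [Matrix.map_apply, Matrix.one_apply_eq] at h2
      have h3 := map_mul f (V i i) 1
      rwa [mul_one, h2, one_mul, eq_comm] at h3
    rw [Matrix.sub_apply, map_sub, h1]
    rcases eq_or_ne i j with rfl | hij
    · simp [hf1]
    · simp [hij]
  -- At `T = b c` the map `φ` is `V⋆(1 + b c)`, so `1 + b c` becomes left invertible with the same
  -- defect as `V`, up to equivalence.
  obtain ⟨b, c, hb, hc, σ, hσ⟩ := exists_columnRow_isUnit hf hq hq0 hfq hfa
    (φ := fun T => 1 + Vᴴ * (T - (V - 1))) (by fun_prop) (by simp)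
  have hσ' : (σ : Matrix ι ι B) = Vᴴ * (1 + b * c) := by
    rw [hσ, Matrix.mul_sub, Matrix.mul_sub, hV, Matrix.mul_add]
    abel
  set s : Matrix ι ι B := ↑σ⁻¹
  have hsσ : s * (Vᴴ * (1 + b * c)) = 1 := by rw [← hσ', Units.inv_mul]
  have hσs : Vᴴ * (1 + b * c) * s = 1 := by rw [← hσ', Units.mul_inv]
  set X := s * Vᴴ with hX
  have hXV : X * (1 + b * c) = 1 := by rw [hX, Matrix.mul_assoc, hsσ]
  set g := 1 - (1 + b * c) * X with hg
  set p' := 1 - V * Vᴴ with hp'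
  have hgV : g + g * b * c = 0 := by
    have : g * (1 + b * c) = 0 := by
      rw [hg, Matrix.sub_mul, Matrix.mul_assoc, hXV, Matrix.one_mul, Matrix.mul_one, sub_self]
    rwa [Matrix.mul_add, Matrix.mul_one, ← Matrix.mul_assoc] at this
  have hgbc : g * b * c = -g := eq_neg_of_add_eq_zero_right hgV
  have hp'g : p' * g = g := by
    have h1 : V * Vᴴ * g = 0 := by
      rw [hg, Matrix.mul_sub, Matrix.mul_one, hX, ← Matrix.mul_assoc (1 + b * c), Matrix.mul_assoc V,
        ← Matrix.mul_assoc Vᴴ, ← Matrix.mul_assoc Vᴴ, hσs, Matrix.one_mul, sub_self]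
    rw [hp', Matrix.sub_mul, h1, Matrix.one_mul, sub_zero]
  have hgp' : g * p' = p' := by
    have h1 : X * p' = 0 := by
      rw [hX, hp', Matrix.mul_sub, Matrix.mul_one, Matrix.mul_assoc, ← Matrix.mul_assoc Vᴴ, hV,
        Matrix.one_mul, sub_self]
    rw [hg, Matrix.sub_mul, Matrix.mul_assoc, h1, Matrix.one_mul, Matrix.mul_zero, sub_zero]
  -- Exchange of factors: `X'` is a left inverse of `Q + c b` in the corner of `q`, and its defect
  -- idempotent `g' = -c g b` is equivalent to `g`.
  set V' := Q + c * b with hV'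
  set X' := Q - c * X * b with hX'
  set g' := -(c * g * b) with hg'
  have hcXb : X + b * c * X = 1 - g := by
    rw [hg, Matrix.add_mul, Matrix.one_mul]; abel
  have hXbc : X + X * b * c = 1 := by
    rw [← hXV, Matrix.mul_add, Matrix.mul_one, Matrix.mul_assoc]
  have hQc : Q * c = c := hc
  have hbQ : b * Q = b := hb
  have hX'V' : X' * V' = Q := by
    have h1 : X' * V' = Q + c * b - c * (X + X * b * c) * b := by
      rw [hX', hV']
      simp only [Matrix.mul_add, Matrix.sub_mul, Matrix.add_mul, ← Matrix.mul_assoc, hQQ, hQc]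
      rw [Matrix.mul_assoc _ b Q, hbQ]
      abel
    rw [h1, hXbc, Matrix.mul_one, add_sub_cancel_right]
  have hV'X' : Q - V' * X' = g' := by
    have h1 : V' * X' = Q + c * b - c * (X + b * c * X) * b := by
      rw [hX', hV']
      simp only [Matrix.mul_add, Matrix.mul_sub, Matrix.add_mul, ← Matrix.mul_assoc, hQQ, hQc]
      rw [Matrix.mul_assoc c b Q, hbQ]
    rw [h1, hcXb, hg', Matrix.mul_sub, Matrix.sub_mul, Matrix.mul_one]
    abel
  have hQV' : Q * V' = V' := by rw [hV', Matrix.mul_add, hQQ, ← Matrix.mul_assoc, hc]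
  have hV'Q : V' * Q = V' := by rw [hV', Matrix.add_mul, hQQ, Matrix.mul_assoc, hb]
  obtain ⟨h, -, -, -, h4, h5⟩ := exists_polar hQ hV'Q hX'V'
  set E := V' * h * (V' * h)ᴴ with hE
  have hEs : Eᴴ = E := by rw [hE, conjTranspose_mul, conjTranspose_conjTranspose]
  have hEp : IsStarProjection E := by
    refine isStarProjection_of ?_ hEs
    nth_rewrite 2 [hE]
    rw [← Matrix.mul_assoc, ← Matrix.mul_assoc, h5]
  have hQE : Q * E = E := by rw [hE, ← Matrix.mul_assoc, ← Matrix.mul_assoc, hQV']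
  have hFp := isStarProjection_sub hEp hQ hQE
  set F := Q - E with hF
  have hFF := mul_self_of_isStarProjection hFp
  have hQg' : Q * g' = g' := by
    rw [← hV'X', Matrix.mul_sub, hQQ, ← Matrix.mul_assoc, hQV']
  have hEg' : E * g' = E * Q - V' * X' := by
    rw [← hV'X', Matrix.mul_sub, ← Matrix.mul_assoc, h5]
  have hEQ : E * Q = E := by
    have := congrArg conjTranspose hQE
    rwa [conjTranspose_mul, hEs, hQs] at this
  have hFg' : F * g' = F := by
    rw [hF, Matrix.sub_mul, hQg', hEg', hEQ, ← hV'X']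
    abel
  have hV'X'E : V' * X' * E = E := by
    rw [hE, ← Matrix.mul_assoc, ← Matrix.mul_assoc, Matrix.mul_assoc V' X' V', hX'V', hV'Q]
  have hg'F : g' * F = g' := by
    have hX'Q : X' * Q = X' := by
      rw [hX', Matrix.sub_mul, hQQ, Matrix.mul_assoc, hb]
    rw [← hV'X', hF, Matrix.mul_sub, Matrix.sub_mul, Matrix.sub_mul, hQQ, hQE, hV'X'E,
      Matrix.mul_assoc, hX'Q, sub_self, sub_zero]
  -- The idempotents `g` and `p'` have the same range, `g'` and `F` the same kernel. Composing these
  -- with the equivalence of `g` and `g'` gives `p' ∼ F`.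
  have hequiv : MatrixMvN p' F := by
    refine MatrixMvN.of_mul_eq hp hFp (x := F * -c * p') (y := g * b * g') ?_ ?_
    · calc g * b * g' * (F * -c * p') = -(g * b * (g' * F) * c * p') := by
            simp only [Matrix.mul_neg, Matrix.neg_mul, Matrix.mul_assoc]
        _ = (g * b * c) * (g * b * c) * p' := by
            rw [hg'F, hg']
            simp only [Matrix.mul_neg, Matrix.neg_mul, Matrix.mul_assoc, neg_neg]
        _ = p' := by
            rw [hgbc, Matrix.neg_mul, Matrix.mul_neg, neg_neg, Matrix.mul_assoc, hgp', hgp']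
    · calc F * -c * p' * (g * b * g') = F * -(c * (p' * g) * b) * g' := by
            simp only [Matrix.mul_neg, Matrix.neg_mul, Matrix.mul_assoc]
        _ = F := by rw [hp'g, ← hg', hFg', hFg']
  have hQEequiv : MatrixMvN Q E := ⟨V' * h, h4, rfl⟩
  rw [(projClass_eq_iff hp hFp).2 hequiv, add_comm]
  nth_rewrite 1 [(projClass_eq_iff hQ hEp).2 hQEequiv]
  exact projClass_add_sub hEp hQ hQE

/-- Split the equivalence `p ⊕ 1 ∼ 1` into a column `u` and an isometry `V` with `1 - V V⋆ = u u⋆ ∼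
p`. The absorbing class is `z` itself. -/
theorem exists_add_eq_self_of_add_oneClass {f : B →⋆ₙ+* ℝ} (hf : IsPurelyInfiniteSimpleKer f)
    (hfa : ∀ s : ℝ, f (algebraMap ℝ B s) = s) {z : ProjectionMonoid B} (hz : z ∈ kerClasses f)
    (h : z + oneClass B ι = oneClass B ι) : ∃ w ∈ kerClasses f, z + w = w := by
  obtain ⟨p, hp, hp0, hfp, rfl⟩ := hz
  have hP := isStarProjection_oneByOne hp
  rw [oneClass, ← projClass_fromBlocks, projClass_eq_iff] at h
  obtain ⟨U, h1, h2⟩ := h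
  obtain ⟨u, V, rfl⟩ : ∃ (u : Matrix ι (Fin 1) B) (V : Matrix ι ι B), U = fromCols u V :=
    ⟨_, _, (fromCols_toCols U).symm⟩
  rw [conjTranspose_fromCols_eq_fromRows_conjTranspose, fromRows_mul_fromCols, fromBlocks_inj] at h1
  rw [conjTranspose_fromCols_eq_fromRows_conjTranspose, fromCols_mul_fromRows] at h2
  obtain ⟨hu, -, -, hV⟩ := h1
  have hpV : 1 - V * Vᴴ = u * uᴴ := by rw [← h2, add_sub_cancel_right]
  -- The real numbers `f (uᵢ)` have squares summing to `f p = 0`.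
  have hfu : ∀ i j, f (u i j) = 0 := by
    have h3 : ∑ i, f (u i 0) ^ 2 = 0 := by
      have h4 := congrArg f (congrFun (congrFun hu 0) 0)
      rw [oneByOne_apply, hfp, Matrix.mul_apply, map_sum] at h4
      rw [← h4]
      refine Finset.sum_congr rfl fun i _ => ?_
      rw [map_mul, conjTranspose_apply, map_star, star_trivial, pow_two]
    intro i j
    rw [Finset.sum_eq_zero_iff_of_nonneg fun _ _ => sq_nonneg _] at h3
    rw [Subsingleton.elim j 0]
    exact pow_eq_zero_iff two_ne_zero |>.1 (h3 i (Finset.mem_univ i))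
  have hfV : (V * Vᴴ).map f = 1 := by
    have h5 : V * Vᴴ = 1 - u * uᴴ := by rw [← hpV, sub_sub_cancel]
    have h6 : (u * uᴴ).map f = 0 := by
      rw [Matrix.map_mul]
      have : u.map f = 0 := by ext i j; exact hfu i j
      rw [this, Matrix.zero_mul]
    have hf1 : f 1 = 1 := by simpa using hfa 1
    rw [h5, Matrix.map_sub _ (map_sub f), h6, Matrix.map_one _ (map_zero f) hf1, sub_zero]
  obtain ⟨W, hW, hWW, hfW⟩ := exists_isometry_map_eq_one hfa hV hfV
  have hpp : IsStarProjection (1 - W * Wᴴ) := by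
    refine isStarProjection_sub (isStarProjection_of ?_ ?_) (.one _) (Matrix.one_mul _)
    · rw [Matrix.mul_assoc, ← Matrix.mul_assoc Wᴴ, hW, Matrix.one_mul]
    · rw [conjTranspose_mul, conjTranspose_conjTranspose]
  refine ⟨_, ⟨p, hp, hp0, hfp, rfl⟩, ?_⟩
  have h7 := exists_add_eq_self_of_isometry hf hp hp0 hfp hW hfW hpp
  have h8 : projClass (oneByOne p) hP = projClass (1 - W * Wᴴ) hpp := by
    rw [projClass_eq_iff]
    exact ⟨u, hu, by rw [hWW, hpV]⟩
  nth_rewrite 1 [h8]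
  exact h7

theorem eq_of_of_eq_of {f : B →⋆ₙ+* ℝ} (hf : IsPurelyInfiniteSimpleKer f)
    (hfa : ∀ s : ℝ, f (algebraMap ℝ B s) = s) {x y : ProjectionMonoid B}
    (hx : x ∈ kerClasses f) (hy : y ∈ kerClasses f)
    (h : GrothendieckAddGroup.of x = GrothendieckAddGroup.of y) : x = y := by
  obtain ⟨e, he, hneutral, hcancel⟩ := exists_zero_and_cancel_of_solvable (S := kerClasses f) ⟨x, hx⟩
    (fun a ha b hb => exists_add_eq_of_mem_kerClasses hf ha hb)
  obtain ⟨c, hc⟩ := of_eq_of_iff.1 h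
  obtain ⟨c', n, hn⟩ := exists_add_eq_oneClass c
  obtain ⟨y', m, hm⟩ := exists_add_eq_oneClass y
  obtain ⟨z, hz, rfl⟩ := exists_add_eq_of_mem_kerClasses hf hy hx
  -- Adding the complements of `c` and of `y` turns `c + y + z = c + y` into a statement about
  -- identity matrices.
  have h1 : z + oneClass B (Fin n ⊕ Fin m) = oneClass B (Fin n ⊕ Fin m) := by
    rw [← oneClass_add, ← hn, ← hm]
    calc z + (c + c' + (y + y')) = (c + (y + z)) + (c' + y') := by abel
      _ = (c + y) + (c' + y') := by rw [hc]
      _ = c + c' + (y + y') := by abel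
  obtain ⟨w, hw, hzw⟩ := exists_add_eq_self_of_add_oneClass hf hfa hz h1
  rw [hcancel z hz e he w hw (by rw [hzw, add_comm, hneutral w hw]), hneutral y hy]

/-- A projection `P` which modulo the kernel of `f` is equivalent to `1` is, stably, a subprojection
of `1 ⊕ q`. -/
theorem exists_projClass_add_eq_oneClass_add {f : B →⋆ₙ+* ℝ} (hf : IsPurelyInfiniteSimpleKer f)
    (hfa : ∀ s : ℝ, f (algebraMap ℝ B s) = s) {q : B} (hq : IsStarProjection q) (hq0 : q ≠ 0)
    (hfq : f q = 0) {P : Matrix ι ι B} (hP : IsStarProjection P)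
    (hfP : MatrixMvN (P.map f) (1 : Matrix κ κ ℝ)) :
    ∃ (r : Matrix (κ ⊕ Fin 1) (κ ⊕ Fin 1) B) (hr : IsStarProjection r), (∀ i j, f (r i j) = 0) ∧
      projClass P hP + projClass r hr
        = oneClass B κ + projClass (oneByOne q) (isStarProjection_oneByOne hq) := by
  have hPP := mul_self_of_isStarProjection hP
  have hPs := conjTranspose_of_isStarProjection hP
  have hf1 : f 1 = 1 := by simpa using hfa 1
  obtain ⟨v, hv1, hv2⟩ := hfP
  have hvP : v * P.map f = v := by rw [← hv1, ← Matrix.mul_assoc, hv2, Matrix.one_mul]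
  set Q := oneByOne q
  have hQ : IsStarProjection Q := isStarProjection_oneByOne hq
  set K : Matrix κ ι B := v.map (algebraMap ℝ B) with hK
  have hKf : K.map f = v := by ext i j; simp [hK, hfa]
  have hPf : P.map f * P.map f = P.map f := by rw [← Matrix.map_mul, hPP]
  -- The scalar lift `K` of `v` carries `P` to `1` only modulo the kernel. The error `a` is
  -- approximated by `b c`, and the row `c P` is appended to `K P` to make the map left invertible
  -- on `P`.
  set a := P - P * Kᴴ * (K * P) with ha
  have hfa' : a.map f = 0 := by
    rw [ha, Matrix.map_sub _ (map_sub f), Matrix.map_mul, Matrix.map_mul, Matrix.map_mul,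
      map_conjTranspose_of_star, hKf, hvP, Matrix.mul_assoc, hv1, hPf, sub_self]
  have haP : P * a * P = a := by
    have h1 : P * (P * Kᴴ * (K * P)) * P = P * P * Kᴴ * (K * (P * P)) := by
      simp only [Matrix.mul_assoc]
    rw [ha, Matrix.mul_sub, Matrix.sub_mul, hPP, hPP, h1, hPP]
  obtain ⟨b, c, hb, hc, z, hz⟩ := exists_columnRow_isUnit hf hq hq0 hfq
    (fun i j => congrFun (congrFun hfa' i) j)
    (φ := fun T => 1 - (a - P * T * P)) (by fun_prop) (by simp [haP])
  set V := fromRows (K * P) (c * P) with hV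
  have hVP : V * P = V := by
    rw [hV, fromRows_mul, Matrix.mul_assoc, Matrix.mul_assoc, hPP]
  have hzP : (z : Matrix ι ι B) * P = fromCols (P * Kᴴ) (P * b) * V := by
    have haP' : a * P = a := by rw [← haP, Matrix.mul_assoc, hPP]
    rw [hz, hV, fromCols_mul_fromRows, Matrix.sub_mul, Matrix.sub_mul, Matrix.one_mul, haP',
      Matrix.mul_assoc _ P P, hPP, ha]
    simp only [Matrix.mul_assoc]
    abel
  obtain ⟨h, hhs, hhw, -, h4, h5⟩ := exists_polar
    (X := (↑z⁻¹ : Matrix ι ι B) * fromCols (P * Kᴴ) (P * b)) hP hVP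
    (by rw [Matrix.mul_assoc, ← hzP, ← Matrix.mul_assoc, Units.inv_mul, Matrix.one_mul])
  set E := V * h * (V * h)ᴴ with hE
  have hEs : Eᴴ = E := by rw [hE, conjTranspose_mul, conjTranspose_conjTranspose]
  have hEp : IsStarProjection E := by
    refine isStarProjection_of ?_ hEs
    nth_rewrite 2 [hE]
    rw [← Matrix.mul_assoc, ← Matrix.mul_assoc, h5]
  have hN : IsStarProjection (fromBlocks (1 : Matrix κ κ B) 0 0 Q) :=
    isStarProjection_fromBlocks (.one _) hQ
  have hNV : fromBlocks (1 : Matrix κ κ B) 0 0 Q * V = V := by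
    rw [hV, fromBlocks_mul_fromRows, Matrix.one_mul, Matrix.zero_mul, Matrix.zero_mul, add_zero,
      zero_add, ← Matrix.mul_assoc, hc]
  have hNE : fromBlocks (1 : Matrix κ κ B) 0 0 Q * E = E := by
    rw [hE, ← Matrix.mul_assoc, ← Matrix.mul_assoc, hNV]
  have hQf : Q.map f = 0 := by ext i j; exact hfq
  have hcf : c.map f = 0 := by rw [← hc, Matrix.map_mul, hQf, Matrix.zero_mul]
  have hVf : V.map f = fromRows v 0 := by
    have : V.map f = fromRows ((K * P).map f) ((c * P).map f) := by
      ext (i | i) j <;> rfl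
    rw [this, Matrix.map_mul, Matrix.map_mul, hKf, hvP, hcf, Matrix.zero_mul]
  have h1f : (1 : Matrix ι ι B).map f = 1 := Matrix.map_one _ (map_zero f) hf1
  have hhf : (h * h).map f = 1 := by
    have hw : (Vᴴ * V + (1 - P)).map f = 1 := by
      rw [Matrix.map_add _ (map_add f), Matrix.map_sub _ (map_sub f), Matrix.map_mul,
        map_conjTranspose_of_star, hVf, h1f, conjTranspose_fromRows_eq_fromCols_conjTranspose,
        fromCols_mul_fromRows, hv1, Matrix.mul_zero, add_zero, add_sub_cancel]
    have := congrArg (fun M : Matrix ι ι B => M.map f) hhw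
    simp only [Matrix.map_mul (M := Vᴴ * V + (1 - P))] at this
    rwa [hw, h1f, Matrix.mul_one] at this
  -- Modulo the kernel `E` is `1 ⊕ 0`, the same as `1 ⊕ q`, so their difference has entries in the
  -- kernel.
  have hEf : E.map f = fromBlocks 1 0 0 0 := by
    have : E = V * (h * h) * Vᴴ := by
      rw [hE, conjTranspose_mul, hhs]; simp only [Matrix.mul_assoc]
    rw [this, Matrix.map_mul, Matrix.map_mul, hhf, Matrix.mul_one, map_conjTranspose_of_star, hVf,
      conjTranspose_fromRows_eq_fromCols_conjTranspose, fromRows_mul_fromCols, hv2]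
    simp
  refine ⟨fromBlocks 1 0 0 Q - E, isStarProjection_sub hEp hN hNE, fun i j => ?_, ?_⟩
  · have h9 : (fromBlocks (1 : Matrix κ κ B) 0 0 Q - E).map f = 0 := by
      rw [Matrix.map_sub _ (map_sub f), hEf, fromBlocks_map, hQf,
        Matrix.map_one _ (map_zero f) hf1, Matrix.map_zero _ (map_zero f),
        Matrix.map_zero _ (map_zero f), sub_self]
    exact congrFun (congrFun h9 i) j
  · rw [(projClass_eq_iff hP hEp).2 ⟨V * h, h4, rfl⟩, projClass_add_sub hEp hN hNE,
      projClass_fromBlocks]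
    rfl

theorem exists_of_eq_of_map_eq_zero {f : B →⋆ₙ+* ℝ} (hf : IsPurelyInfiniteSimpleKer f)
    (hfa : ∀ s : ℝ, f (algebraMap ℝ B s) = s) (hne : (kerClasses f).Nonempty) {α : K0 B}
    (hα : K0.map f α = 0) : ∃ x ∈ kerClasses f, α = GrothendieckAddGroup.of x := by
  obtain ⟨x, y, rfl⟩ := exists_of_sub_of α
  obtain ⟨y', m, hm⟩ := exists_add_eq_oneClass y
  have hf1 : f 1 = 1 := by simpa using hfa 1
  have hmap1 : ∀ k : ℕ, ProjectionMonoid.map f (oneClass B (Fin k)) = oneClass ℝ (Fin k) := by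
    intro k
    rw [oneClass, projectionMonoid_map_projClass, oneClass]
    congr 1
    exact Matrix.map_one _ (map_zero f) hf1
  rw [map_sub, K0.map_of, K0.map_of, sub_eq_zero] at hα
  obtain ⟨c, hc⟩ := of_eq_of_iff.1 hα
  obtain ⟨c', l, hl⟩ := exists_add_eq_oneClass c
  -- Adding `y'` replaces `y` by an identity class, and adding the `l`-fold unit absorbs the
  -- cancellation witness `c` in `V(ℝ)`.
  have h1 : ProjectionMonoid.map f (x + y' + oneClass B (Fin l))
      = oneClass ℝ (Fin m ⊕ Fin l) := by
    rw [map_add, map_add, hmap1, ← oneClass_add, ← hmap1 m, ← hm, map_add, ← hl]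
    calc _ = (c + ProjectionMonoid.map f x) + (ProjectionMonoid.map f y' + c') := by abel
      _ = (c + ProjectionMonoid.map f y) + (ProjectionMonoid.map f y' + c') := by rw [hc]
      _ = _ := by abel
  obtain ⟨⟨n, P, hP⟩, hPx⟩ := Quotient.exists_rep (x + y' + oneClass B (Fin l))
  have hPx' : projClass P hP = x + y' + oneClass B (Fin l) := by
    rw [← hPx]; exact (mk_eq_projClass ⟨n, P, hP⟩).symm
  rw [← hPx', projectionMonoid_map_projClass, oneClass, projClass_eq_iff] at h1
  obtain ⟨w, q, hq, hq0, hfq, rfl⟩ := hne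
  obtain ⟨r, hr, hfr, hsum⟩ := exists_projClass_add_eq_oneClass_add hf hfa hq hq0 hfq hP h1
  obtain ⟨u, hu, hru⟩ := exists_projClass_add_eq hf hr hfr
    (b := projClass (oneByOne q) (isStarProjection_oneByOne hq)) ⟨q, hq, hq0, hfq, rfl⟩
  refine ⟨u, hu, ?_⟩
  have h2 := congrArg GrothendieckAddGroup.of hsum
  rw [← hru, hPx', ← oneClass_add, ← hm] at h2
  simp only [map_add] at h2
  rw [sub_eq_iff_eq_add]
  generalize GrothendieckAddGroup.of x = x₁ at *
  generalize GrothendieckAddGroup.of y = y₁ at *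
  generalize GrothendieckAddGroup.of y' = y₂ at *
  generalize GrothendieckAddGroup.of u = u₁ at *
  generalize GrothendieckAddGroup.of (oneClass B (Fin l)) = l₁ at *
  generalize GrothendieckAddGroup.of (projClass r hr) = r₁ at *
  have h3 : x₁ + (y₂ + l₁ + r₁) = u₁ + y₁ + (y₂ + l₁ + r₁) := by
    rw [← sub_eq_zero] at h2 ⊢
    rw [← h2]; abel
  exact add_right_cancel h3

end Kernel

/-! ### Application to the unitization of `A` -/

section Unitization

variable {A : Type*} [RealCStarAlgebra A]

/-- The unitization of a real C⋆-algebra is a unital real C⋆-algebra. -/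
noncomputable instance unitizationUnitalRealCStarAlgebra :
    UnitalRealCStarAlgebra (Unitization ℝ A) where
  isUnit_one_add_star_mul_self b := by
    refine isUnit_one_add_star_mul_self_of_ker (Unitization.fstHom ℝ A) (fun x => ?_)
      (fun a ha => ?_) b
    · exact Unitization.fst_star x
    · have h : a = ((a.snd : A) : Unitization ℝ A) := Unitization.ext ha rfl
      have h1 := RealCStarAlgebra.isUnit_one_add_star_mul_self a.snd
      rw [Unitization.inr_mul, Unitization.inr_star, ← h] at h1
      exact h1

theorem exists_isometry_of_isPurelyInfinite (hinf : IsPurelyInfinite A) {q : A}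
    (hq : IsStarProjection q) (hq0 : q ≠ 0) :
    ∃ v : A, star v * v = q ∧ q * v = v ∧ v * star v ≠ q := by
  have hqq : q * q = q := hq.isIdempotentElem.eq
  have hqs : star q = q := hq.isSelfAdjoint.star_eq
  obtain ⟨e, he, hep, e', he', hee', hne, w, hw, hw'⟩ := hinf q hq0 ⟨q, by rw [hqs, hqq]⟩
  have hees : star e = e := hep.isSelfAdjoint.star_eq
  have hee : e * e = e := hep.isIdempotentElem.eq
  have hqe : q * e = e := by
    have hcl : IsClosed {x : A | q * x = x} := isClosed_eq (by fun_prop) (by fun_prop)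
    refine closure_minimal ?_ hcl he
    rintro _ ⟨a, rfl⟩
    show q * (q * a * q) = q * a * q
    rw [← mul_assoc, ← mul_assoc, hqq]
  have heq : e * q = e := by
    have := congrArg star hqe
    rwa [star_mul, hqs, hees] at this
  have hwe : w * e = w := mul_eq_self_of_star_mul_self_eq hep hw
  have hsw : star w * e' = star w :=
    mul_eq_self_of_star_mul_self_eq he' (by rw [star_star, hw'])
  have hew : e * w = w := by
    have h1 : e' * w = w := by
      have := congrArg star hsw
      rwa [star_mul, star_star, he'.isSelfAdjoint.star_eq] at this
    rw [← h1, ← mul_assoc, hee']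
  have hqw : q * w = w := by rw [← hew, ← mul_assoc, hqe]
  have hwq : w * q = w := by rw [← hwe, mul_assoc, heq]
  have hswe : star w * e = star w := by
    have := congrArg star hew
    rwa [star_mul, hees] at this
  have hswq : star w * q = star w := by
    have := congrArg star hqw
    rwa [star_mul, hqs] at this
  have hqsw : q * star w = star w := by
    have := congrArg star hwq
    rwa [star_mul, hqs] at this
  have hesw : e * star w = star w := by
    have := congrArg star hwe
    rwa [star_mul, hees] at this
  -- Extend the proper isometry `w` of the infinite subprojection `e` by the identity on `q - e`.
  refine ⟨w + (q - e), ?_, ?_, ?_⟩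
  · simp only [star_add, star_sub, hqs, hees, add_mul, mul_add, sub_mul, mul_sub, hw, hswq, hswe,
      hqw, hew, hqq, hqe, heq, hee]
    abel
  · rw [mul_add, mul_sub, hqw, hqq, hqe]
  · have h : (w + (q - e)) * star (w + (q - e)) = e' + q - e := by
      simp only [star_add, star_sub, hqs, hees, add_mul, mul_add, sub_mul, mul_sub, hw', hqsw, hesw,
        hwq, hwe, hqq, hqe, heq, hee]
      abel
    rw [h]
    intro h2
    apply hne
    have h3 : e' - e = 0 := by
      calc e' - e = e' + q - e - q := by abel
        _ = 0 := by rw [h2, sub_self]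
    exact sub_eq_zero.1 h3

/-- The closure of the sums of terms `a r b` is a closed ideal, and it contains `r = r r r`. Real
scalars are absorbed into `a`, so additive closure suffices. -/
theorem mem_closure_of_isSimple (hs : IsSimple A) {r : A} (hr : r * r = r) (hr0 : r ≠ 0) (x : A) :
    x ∈ closure (AddSubmonoid.closure {y : A | ∃ a b, y = a * r * b} : Set A) := by
  set S := {y : A | ∃ a b, y = a * r * b} with hS
  let J : Submodule ℝ A :=
    { AddSubmonoid.closure S with
      smul_mem' := by
        intro c x hx
        change c • x ∈ AddSubmonoid.closure S
        change x ∈ AddSubmonoid.closure S at hx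
        induction hx using AddSubmonoid.closure_induction with
        | mem y hy =>
          obtain ⟨a, b, rfl⟩ := hy
          exact AddSubmonoid.subset_closure ⟨c • a, b, by rw [smul_mul_assoc, smul_mul_assoc]⟩
        | zero => rw [smul_zero]; exact zero_mem _
        | add y z _ _ hy hz => rw [smul_add]; exact add_mem hy hz }
  have hJ : ∀ a : A, ∀ x ∈ J, a * x ∈ J ∧ x * a ∈ J := by
    intro a x hx
    change x ∈ AddSubmonoid.closure S at hx
    change a * x ∈ AddSubmonoid.closure S ∧ x * a ∈ AddSubmonoid.closure S
    induction hx using AddSubmonoid.closure_induction with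
    | mem y hy =>
      obtain ⟨b, c, rfl⟩ := hy
      exact ⟨AddSubmonoid.subset_closure ⟨a * b, c, by simp only [mul_assoc]⟩,
        AddSubmonoid.subset_closure ⟨b, c * a, by simp only [mul_assoc]⟩⟩
    | zero => simp [zero_mem]
    | add y z _ _ hy hz =>
      rw [mul_add, add_mul]
      exact ⟨add_mem hy.1 hz.1, add_mem hy.2 hz.2⟩
  rcases hs.2 J.topologicalClosure J.isClosed_topologicalClosure (fun a x hx =>
    ⟨map_mem_closure (continuous_const_mul a) hx fun y hy => (hJ a y hy).1,
      map_mem_closure (f := (· * a)) (continuous_mul_const a) hx fun y hy => (hJ a y hy).2⟩) with h | h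
  · refine absurd ?_ hr0
    have h1 : r ∈ J.topologicalClosure :=
      J.le_topologicalClosure (AddSubmonoid.subset_closure ⟨r, r, by rw [hr, hr]⟩)
    rwa [h, Submodule.mem_bot] at h1
  · have h1 : x ∈ J.topologicalClosure := by rw [h]; exact Submodule.mem_top
    exact h1

theorem inr_snd_of_fst_eq_zero {x : Unitization ℝ A} (h : unitizationFst A x = 0) :
    ((x.snd : A) : Unitization ℝ A) = x := Unitization.ext h.symm rfl

theorem unitizationFst_inr (x : A) : unitizationFst A (x : Unitization ℝ A) = 0 := rfl

theorem unitizationFst_algebraMap (s : ℝ) :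
    unitizationFst A (algebraMap ℝ (Unitization ℝ A) s) = s := rfl

theorem isStarProjection_inr {p : A} : IsStarProjection (p : Unitization ℝ A) ↔ IsStarProjection p :=
  ⟨fun h => ⟨Unitization.inr_injective ((Unitization.inr_mul ℝ p p).trans h.1),
    Unitization.inr_injective ((Unitization.inr_star (R := ℝ) p).trans h.2)⟩,
   fun h => ⟨(Unitization.inr_mul ℝ p p).symm.trans (congrArg _ h.1),
    (Unitization.inr_star (R := ℝ) p).symm.trans (congrArg _ h.2)⟩⟩

theorem isPurelyInfiniteSimpleKer_unitizationFst (hs : IsSimple A) (hinf : IsPurelyInfinite A) :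
    IsPurelyInfiniteSimpleKer (unitizationFst A) where
  dense r hr hr0 hfr x hx := by
    rw [← inr_snd_of_fst_eq_zero hfr] at hr hr0 ⊢
    rw [← inr_snd_of_fst_eq_zero hx]
    have hr' := isStarProjection_inr.1 hr
    have hr0' : r.snd ≠ 0 := fun h => hr0 (by rw [h, Unitization.inr_zero])
    refine map_mem_closure Unitization.continuous_inr
      (mem_closure_of_isSimple hs hr'.isIdempotentElem.eq hr0' x.snd) ?_
    intro y hy
    change y ∈ AddSubmonoid.closure _ at hy
    change _ ∈ AddSubmonoid.closure _
    induction hy using AddSubmonoid.closure_induction with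
    | mem y hy =>
      obtain ⟨a, b, rfl⟩ := hy
      refine AddSubmonoid.subset_closure ⟨a, b, rfl, rfl, ?_⟩
      rw [Unitization.inr_mul, Unitization.inr_mul]
    | zero => exact zero_mem _
    | add y z _ _ hy hz =>
      rw [Unitization.inr_add]
      exact add_mem hy hz
  infinite q hq hq0 hfq := by
    rw [← inr_snd_of_fst_eq_zero hfq] at hq hq0 ⊢
    obtain ⟨v, h1, h2, h3⟩ := exists_isometry_of_isPurelyInfinite hinf (isStarProjection_inr.1 hq)
      (fun h => hq0 (by rw [h, Unitization.inr_zero]))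
    refine ⟨v, rfl, ?_, ?_, fun h => h3 (Unitization.inr_injective (R := ℝ) ?_)⟩
    · rw [← h1, Unitization.inr_mul, Unitization.inr_star]
    · nth_rewrite 2 [← h2]
      rw [Unitization.inr_mul]
    · rw [← h, Unitization.inr_mul, Unitization.inr_star]

/-- Passing to the unitization creates no new equivalences: if `v⋆v = p` then `f(v)² = f(p) = 0`, so
`v` lies in `A`. -/
theorem mvN_iff_matrixMvN {p q : A} :
    MvN p q ↔ MatrixMvN (oneByOne (p : Unitization ℝ A)) (oneByOne (q : Unitization ℝ A)) := by
  constructor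
  · rintro ⟨v, rfl, rfl⟩
    refine ⟨oneByOne (v : Unitization ℝ A), ?_, ?_⟩
    · rw [← oneByOne_star, ← oneByOne_mul, Unitization.inr_mul, Unitization.inr_star]
    · rw [← oneByOne_star, ← oneByOne_mul, Unitization.inr_mul, Unitization.inr_star]
  · rintro ⟨v, h1, h2⟩
    rw [← oneByOne_eta v, ← oneByOne_star, ← oneByOne_mul] at h1 h2
    replace h1 := oneByOne_injective h1
    replace h2 := oneByOne_injective h2
    have h0 : unitizationFst A (v 0 0) = 0 := by
      have h3 := congrArg (unitizationFst A) h1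
      rw [map_mul, map_star, star_trivial, unitizationFst_inr] at h3
      exact mul_self_eq_zero.1 h3
    rw [← inr_snd_of_fst_eq_zero h0, ← Unitization.inr_star, ← Unitization.inr_mul] at h1 h2
    exact ⟨_, Unitization.inr_injective h1, Unitization.inr_injective h2⟩

theorem KO0.coe_ofProjection {p : A} (hp : IsStarProjection p) :
    (KO0.ofProjection p hp : K0 (Unitization ℝ A)) = GrothendieckAddGroup.of
      (projClass (oneByOne (p : Unitization ℝ A))
        (isStarProjection_oneByOne (isStarProjection_inr.2 hp))) :=
  congrArg GrothendieckAddGroup.of (mk_eq_projClass (unitizationProjection p hp))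

theorem inr_ne_zero {p : A} (hp : p ≠ 0) : (p : Unitization ℝ A) ≠ 0 :=
  fun h => hp (Unitization.inr_injective (h.trans (Unitization.inr_zero ℝ).symm))

theorem projClass_mem_kerClasses {p : A} (hp : IsStarProjection p) (hp0 : p ≠ 0) :
    projClass (oneByOne (p : Unitization ℝ A))
      (isStarProjection_oneByOne (isStarProjection_inr.2 hp)) ∈ kerClasses (unitizationFst A) :=
  ⟨p, isStarProjection_inr.2 hp, inr_ne_zero hp0, rfl, rfl⟩

theorem exists_mvN_subprojection (hs : IsSimple A) (hinf : IsPurelyInfinite A) {p q : A}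
    (hp : IsStarProjection p) (hq : IsStarProjection q) (hq0 : q ≠ 0) :
    ∃ e : A, IsStarProjection e ∧ q * e = e ∧ e ≠ q ∧ MvN p e := by
  obtain ⟨e, he, hqe, hne, h⟩ := exists_subprojection
    (isPurelyInfiniteSimpleKer_unitizationFst hs hinf) (isStarProjection_inr.2 hq)
    (inr_ne_zero hq0) rfl (isStarProjection_oneByOne (isStarProjection_inr.2 hp)) fun _ _ => rfl
  have hfe : unitizationFst A e = 0 := map_eq_zero_of_mul_eq (f := unitizationFst A) rfl hqe
  rw [← inr_snd_of_fst_eq_zero hfe] at he hqe hne h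
  rw [← Unitization.inr_mul] at hqe
  exact ⟨e.snd, isStarProjection_inr.1 he, Unitization.inr_injective hqe,
    fun h => hne (congrArg _ h), mvN_iff_matrixMvN.2 h⟩

theorem MvN.ne_zero {p q : A} (h : MvN p q) (hp : p ≠ 0) : q ≠ 0 := by
  obtain ⟨v, rfl, rfl⟩ := h
  rw [Ne, CStarRing.mul_star_self_eq_zero_iff]
  rwa [Ne, CStarRing.star_mul_self_eq_zero_iff] at hp

/-- Place a copy `e` of `p` properly inside `q`, then a copy of `q` inside the nonzero projection `q
- e`. -/
theorem exists_orthogonal_toClass_eq (hs : IsSimple A) (hinf : IsPurelyInfinite A)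
    (p q : NonzeroProjection A) : ∃ p' q' : NonzeroProjection A,
      p'.toClass = p.toClass ∧ q'.toClass = q.toClass ∧ (p' : A) * (q' : A) = 0 := by
  obtain ⟨e, he, hqe, hne, hpe⟩ := exists_mvN_subprojection hs hinf p.2.1 q.2.1 q.2.2
  have hee : e * e = e := he.isIdempotentElem.eq
  have heq : e * q = e := by
    have := congrArg star hqe
    rwa [star_mul, he.isSelfAdjoint.star_eq, q.2.1.isSelfAdjoint.star_eq] at this
  have hqq : (q : A) * q = q := q.2.1.isIdempotentElem.eq
  have hd : IsStarProjection ((q : A) - e) := by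
    refine ⟨?_, ?_⟩
    · show ((q : A) - e) * (q - e) = q - e
      rw [mul_sub, sub_mul, sub_mul, hqq, heq, hqe, hee, sub_self, sub_zero]
    · show star ((q : A) - e) = q - e
      rw [star_sub, he.isSelfAdjoint.star_eq, q.2.1.isSelfAdjoint.star_eq]
  obtain ⟨e', he', hde, -, hqe'⟩ := exists_mvN_subprojection hs hinf q.2.1 hd
    (sub_ne_zero.2 hne.symm)
  refine ⟨⟨e, he, hpe.ne_zero p.2.2⟩, ⟨e', he', hqe'.ne_zero q.2.2⟩, (Quotient.sound hpe).symm,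
    (Quotient.sound hqe').symm, ?_⟩
  show e * e' = 0
  rw [← hde, ← mul_assoc, mul_sub, heq, hee, sub_self, zero_mul]

variable (A) in
/-- The map from Murray–von Neumann classes of nonzero projections of `A` to `KO₀(A)`. -/
noncomputable def classToKO0 : NonzeroProjectionClass A → KO0 A :=
  Quotient.lift (fun p : NonzeroProjection A => KO0.ofProjection (p : A) p.2.1) fun p q h => by
    refine Subtype.ext ?_
    rw [KO0.coe_ofProjection, KO0.coe_ofProjection]
    exact congrArg _ ((projClass_eq_iff _ _).2 (mvN_iff_matrixMvN.1 h))

theorem classToKO0_injective (hs : IsSimple A) (hinf : IsPurelyInfinite A) :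
    Function.Injective (classToKO0 A) := by
  intro x y h
  induction x using Quotient.inductionOn with | _ p
  induction y using Quotient.inductionOn with | _ q
  have h1 : (KO0.ofProjection (p : A) p.2.1 : K0 (Unitization ℝ A))
      = KO0.ofProjection (q : A) q.2.1 := congrArg Subtype.val h
  rw [KO0.coe_ofProjection, KO0.coe_ofProjection] at h1
  have h2 := eq_of_of_eq_of (isPurelyInfiniteSimpleKer_unitizationFst hs hinf)
    unitizationFst_algebraMap (projClass_mem_kerClasses p.2.1 p.2.2)
    (projClass_mem_kerClasses q.2.1 q.2.2) h1
  exact Quotient.sound (mvN_iff_matrixMvN.2 ((projClass_eq_iff _ _).1 h2))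

theorem kerClasses_unitizationFst_nonempty (hs : IsSimple A) (hinf : IsPurelyInfinite A) :
    (kerClasses (unitizationFst A)).Nonempty := by
  obtain ⟨y, hy⟩ := @exists_ne A hs.1 0
  obtain ⟨p, -, hp, q, -, -, hne, h⟩ := hinf (star y * y)
    (by rwa [Ne, CStarRing.star_mul_self_eq_zero_iff]) ⟨y, rfl⟩
  refine ⟨_, projClass_mem_kerClasses hp ?_⟩
  rintro rfl
  obtain ⟨v, h1, h2⟩ := h
  rw [CStarRing.star_mul_self_eq_zero_iff] at h1
  exact hne (by rw [← h2, h1, zero_mul])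

theorem classToKO0_surjective (hs : IsSimple A) (hinf : IsPurelyInfinite A) :
    Function.Surjective (classToKO0 A) := by
  rintro ⟨α, hα⟩
  obtain ⟨_, ⟨p, hp, hp0, hfp, rfl⟩, rfl⟩ := exists_of_eq_of_map_eq_zero
    (isPurelyInfiniteSimpleKer_unitizationFst hs hinf) unitizationFst_algebraMap
    (kerClasses_unitizationFst_nonempty hs hinf) hα
  obtain ⟨p, rfl⟩ : ∃ p' : A, p = p' := ⟨p.snd, (inr_snd_of_fst_eq_zero hfp).symm⟩
  have hp' := isStarProjection_inr.1 hp
  refine ⟨NonzeroProjection.toClass ⟨p, hp', fun h => hp0 (by rw [h, Unitization.inr_zero])⟩,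
    Subtype.ext ?_⟩
  exact KO0.coe_ofProjection hp'

theorem KO0.ofProjection_add {p q r : A} (hp : IsStarProjection p) (hq : IsStarProjection q)
    (hr : IsStarProjection r) (hpq : p * q = 0) (h : r = p + q) :
    KO0.ofProjection p hp + KO0.ofProjection q hq = KO0.ofProjection r hr := by
  subst h
  refine Subtype.ext ?_
  rw [AddSubgroup.coe_add, KO0.coe_ofProjection, KO0.coe_ofProjection, KO0.coe_ofProjection,
    ← map_add]
  refine congrArg _ ((projClass_add _ _ ?_).symm.trans ?_)
  · rw [← oneByOne_mul]
    exact congrArg oneByOne ((Unitization.inr_mul ℝ p q).symm.trans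
      ((congrArg _ hpq).trans (Unitization.inr_zero ℝ)))
  · congr 1
    rw [← oneByOne_add]
    exact congrArg oneByOne (Unitization.inr_add ℝ p q).symm

end Unitization

end RealCStar

theorem mainTheorem7 {A : Type*} [RealCStarAlgebra A]
    (hsimple : RealCStar.IsSimple A) (hinf : RealCStar.IsPurelyInfinite A) :
    (∀ p q : RealCStar.NonzeroProjection A, ∃ p' q' : RealCStar.NonzeroProjection A,
      p'.toClass = p.toClass ∧ q'.toClass = q.toClass ∧ (p' : A) * (q' : A) = 0) ∧
    ∃ _ : AddCommGroup (RealCStar.NonzeroProjectionClass A),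
      (∀ p q r : RealCStar.NonzeroProjection A, (p : A) * (q : A) = 0 → (r : A) = p + q →
        p.toClass + q.toClass = r.toClass) ∧
      ∃ e : RealCStar.NonzeroProjectionClass A ≃+ RealCStar.KO0 A,
        ∀ p : RealCStar.NonzeroProjection A,
          e p.toClass = RealCStar.KO0.ofProjection (p : A) p.2.1 := by
  have hinj := RealCStar.classToKO0_injective hsimple hinf
  -- The group structure is transported along this bijection, so the addition rule reduces to
  -- additivity of `KO0.ofProjection` on orthogonal projections.
  let e := Equiv.ofBijective (RealCStar.classToKO0 A)
    ⟨hinj, RealCStar.classToKO0_surjective hsimple hinf⟩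
  refine ⟨RealCStar.exists_orthogonal_toClass_eq hsimple hinf, e.addCommGroup, ?_, ?_⟩
  · intro p q r hpq hr
    let _ := e.addCommGroup
    refine e.injective ((map_add e.addEquiv _ _).trans ?_)
    exact RealCStar.KO0.ofProjection_add p.2.1 q.2.1 r.2.1 hpq hr
  · let _ := e.addCommGroup
    exact ⟨e.addEquiv, fun p => rfl⟩
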